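/- Let $d\ge 2$ be an integer. A $d$-graph is a connected simple graph whose vertices are of types $1,2,\ldots,d$ and in which every 2-connected component is a cycle of length $d$ with vertices of type $1,2,\ldots,d$ appearing in this order cyclically; these cycles are called $d$-gons (for $d=2$ a $2$-gon is a single edge joining a vertex of type $1$ and a vertex of type $2$). A planar $d$-cactus is a $d$-graph together with a plane embedding, considered up to continuous deformation, in which every edge is incident to the unbounded region and the vertices of type $1,2,\ldots,d$ appear in clockwise order around each $d$-gon; equivalently, it is a $d$-graph together with, for each vertex $v$, a cyclic order of the $d$-gons incident to $v$. Its size is its number of $d$-gons, and it is rooted if one of its $d$-gons is distinguished. Let $\mathbf n=(n_1,\ldots,n_d)$ be a tuple of positive integers. A $d$-cactus with $n_t$ vertices of type $t$ for all $t\in[d]$ is vertex-labeled if, for each $t\in[d]$, the vertices of type $t$ have distinct labels in $[n_t]$. Let $\mathcal C(\mathbf n)$ be the set of rooted vertex-labeled planar $d$-cacti with $n_t$ vertices of type $t$ for all $t\in[d]$. Then $\mathcal C(\mathbf n)$ is finite, and for every non-negative integer $n$ the number of elements of $\mathcal C(\mathbf n)$ of size $n$ is $$n^{d-1}\prod_{t\in[d]}\binom{n-1}{n_t-1}(n_t-1)!$$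 if $\left(\sum_{t\in[d]}n_t-1\right)/(d-1)=n$, and $0$ otherwise. Consequently $|\mathcal C(\mathbf n)|$ is given by the displayed formula if $n:=\left(\sum_{t\in[d]}n_t-1\right)/(d-1)$ is an integer, and $|\mathcal C(\mathbf n)|=0$ if it is not. -/

import Mathlib

open scoped Nat

namespace Cactus

/-- The labelled vertices `(t, i)`: `t` is the type and `i` is the label, with `nn t` labels
available for the type `t`. -/
abbrev Vertex {d : ℕ} (nn : Fin d → ℕ) : Type := Σ t : Fin d, Fin (nn t)

/-- A subgraph with at least two vertices which is connected and has no cut vertex: it stays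
connected when any one of its vertices is deleted. (A single edge has this property.) -/
def IsNonseparable {V : Type} {G : SimpleGraph V} (B : G.Subgraph) : Prop :=
  B.verts.Nontrivial ∧ B.Connected ∧ ∀ v ∈ B.verts, (B.deleteVerts {v}).Connected

/-- A 2-connected component (block) of `G`: a maximal subgraph, for inclusion, among the connected
subgraphs with at least two vertices that have no cut vertex. -/
def IsBlock {V : Type} {G : SimpleGraph V} (B : G.Subgraph) : Prop :=
  Maximal (fun H : G.Subgraph => IsNonseparable H) B

/-- The subgraph `B` is a cycle of length `d` with exactly one vertex of each type, the types
`0, 1, …, d - 1` appearing in this order cyclically. For `d = 2` the graph `cycleGraph 2` is a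
single edge, which stands for the 2-gon. -/
def IsTypedCycle {d : ℕ} {nn : Fin d → ℕ} {G : SimpleGraph (Vertex nn)} (B : G.Subgraph) : Prop :=
  ∃ f : SimpleGraph.cycleGraph d ≃g B.coe, ∀ t : Fin d, (f t : Vertex nn).1 = t

/-- A vertex-labelled `d`-graph with `nn t` vertices of type `t`: a connected simple graph all of
whose 2-connected components are cycles of length `d` with the types in cyclic order. -/
def IsDGraph {d : ℕ} {nn : Fin d → ℕ} (G : SimpleGraph (Vertex nn)) : Prop :=
  G.Connected ∧ ∀ B : G.Subgraph, IsBlock B → IsTypedCycle B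

/-- The `d`-gons of a `d`-graph, which are its 2-connected components. -/
abbrev Gon {V : Type} (G : SimpleGraph V) : Type := {B : G.Subgraph // IsBlock B}

/-- The `d`-gons incident to the vertex `v`. -/
abbrev GonAt {V : Type} (G : SimpleGraph V) (v : V) : Type := {g : Gon G // v ∈ g.1.verts}

end Cactus

/-- A vertex-labelled planar `d`-cactus with `nn t` vertices of type `t` for every `t`: a
vertex-labelled `d`-graph with a plane embedding up to continuous deformation, that is, with a
cyclic order, at every vertex `v`, on the `d`-gons incident to `v`. The cyclic order is given by
its successor map (the next `d`-gon clockwise around `v`), a permutation of the `d`-gons incident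
to `v` consisting of one single cycle. -/
structure LabeledCactus {d : ℕ} (nn : Fin d → ℕ) where
  graph : SimpleGraph (Cactus.Vertex nn)
  isDGraph : Cactus.IsDGraph graph
  next : ∀ v : Cactus.Vertex nn, Equiv.Perm (Cactus.GonAt graph v)
  next_isCycleOn : ∀ v : Cactus.Vertex nn, (next v).IsCycleOn Set.univ

/-- A rooted vertex-labelled planar `d`-cactus: one of the `d`-gons is distinguished. -/
structure RootedLabeledCactus {d : ℕ} (nn : Fin d → ℕ) extends LabeledCactus nn where
  root : Cactus.Gon graph

/-- The size of a `d`-cactus is its number of `d`-gons. -/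
noncomputable def RootedLabeledCactus.size {d : ℕ} {nn : Fin d → ℕ}
    (C : RootedLabeledCactus nn) : ℕ :=
  Nat.card (Cactus.Gon C.graph)

/-! Label the gons by a set `I` of `n` elements: this multiplies the number of cacti of size `n` by
`n!`. At a vertex other than a base vertex of the root gon, exactly one gon contains vertices closer
to the base. Call it the head there; at the base vertex the head is the root gon. Every other gon at
the vertex is entered through that vertex. Cutting the cyclic order just before the head turns it
into a path, and each non-head gon takes its predecessor as parent, along an edge coloured by the
type of the vertex. The result is a tree on `I`, rooted at the root gon, with at most one child of
each colour per gon. The vertices of type `t` are the components of its edges of colour `t`, so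
there are `n - n_t` such edges. Nothing is lost (`card_sigma_equiv_gon`), so it remains to count
these trees with labelled components.

Forests with `m_t` edges of colour `t` are built edge by edge: a new edge of colour `t` needs a
parent without a child of colour `t` (`n - m_t` choices) and the root of another tree (`n - 1 - ∑ m`
choices), and any of the `m_t + 1` edges of that colour may have been the last one added. Thus their
number times `∏ m_t!` is a product of falling factorials (`card_coloredForests`). Trees have `∑ m_t
= n - 1`; taking `m_t = n - n_t`, multiplying by `∏ n_t!` for the labels and dividing by `n!` gives
the formula. -/

namespace Cactus

/-! ### Blocks of a graph and distances -/

section Blocks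

variable {V : Type} {G : SimpleGraph V}

theorem IsNonseparable.connected_deleteVerts {B : G.Subgraph} (h : IsNonseparable B) (v : V) :
    (B.deleteVerts {v}).Connected := by
  by_cases hv : v ∈ B.verts
  · exact h.2.2 v hv
  · rw [← SimpleGraph.Subgraph.deleteVerts_inter_verts_left_eq,
      Set.inter_singleton_eq_empty.2 hv, SimpleGraph.Subgraph.deleteVerts_empty]
    exact h.2.1

theorem IsNonseparable.exists_isBlock_ge [Finite V] {H : G.Subgraph} (h : IsNonseparable H) :
    ∃ B, IsBlock B ∧ H ≤ B := by
  obtain ⟨B, hB, hm⟩ := Set.Finite.exists_le_maximal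
    (Set.toFinite {H : G.Subgraph | IsNonseparable H}) h
  exact ⟨B, hm, hB⟩

theorem isNonseparable_subgraphOfAdj {u v : V} (h : G.Adj u v) :
    IsNonseparable (G.subgraphOfAdj h) := by
  refine ⟨⟨u, by simp, v, by simp, h.ne⟩, SimpleGraph.Subgraph.subgraphOfAdj_connected h, ?_⟩
  intro w hw
  rw [SimpleGraph.Subgraph.connected_iff_forall_exists_walk_subgraph]
  have key : ∃ x, (((G.subgraphOfAdj h).deleteVerts {w}).verts = {x}) := by
    rcases hw with rfl | rfl
    · refine ⟨v, ?_⟩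
      ext x
      simp only [SimpleGraph.Subgraph.deleteVerts_verts, SimpleGraph.subgraphOfAdj_verts]
      have := h.ne
      grind
    · refine ⟨u, ?_⟩
      ext x
      simp only [SimpleGraph.Subgraph.deleteVerts_verts, SimpleGraph.subgraphOfAdj_verts]
      have := h.ne
      grind
  obtain ⟨x, hx⟩ := key
  rw [hx]
  refine ⟨⟨x, rfl⟩, ?_⟩
  rintro a b rfl rfl
  refine ⟨.nil, ?_⟩
  rw [SimpleGraph.Walk.toSubgraph, SimpleGraph.singletonSubgraph_le_iff, hx]
  rfl

theorem exists_isBlock_adj [Finite V] {u v : V} (h : G.Adj u v) :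
    ∃ B : G.Subgraph, IsBlock B ∧ B.Adj u v := by
  obtain ⟨B, hB, hle⟩ := (isNonseparable_subgraphOfAdj h).exists_isBlock_ge
  exact ⟨B, hB, hle.2 (by simp)⟩

theorem connected_of_forall_exists_walk {H K : G.Subgraph} (hK : K.Connected) (hKH : K ≤ H)
    (h : ∀ x ∈ H.verts, ∃ y ∈ K.verts, ∃ p : G.Walk x y, p.toSubgraph ≤ H) : H.Connected := by
  rw [SimpleGraph.Subgraph.connected_iff_forall_exists_walk_subgraph] at hK ⊢
  refine ⟨hK.1.mono hKH.1, ?_⟩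
  intro u v hu hv
  obtain ⟨a, ha, p, hp⟩ := h u hu
  obtain ⟨b, hb, q, hq⟩ := h v hv
  obtain ⟨w, hw⟩ := hK.2 ha hb
  refine ⟨(p.append w).append q.reverse, ?_⟩
  simp only [SimpleGraph.Walk.toSubgraph_append, SimpleGraph.Walk.toSubgraph_reverse]
  exact sup_le (sup_le hp (hw.trans hKH)) hq

theorem le_deleteVerts {H K : G.Subgraph} {v : V} (h : K ≤ H) (hv : v ∉ K.verts) :
    K ≤ H.deleteVerts {v} := by
  have : K.deleteVerts {v} = K := by
    rw [← SimpleGraph.Subgraph.deleteVerts_inter_verts_left_eq,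
      Set.inter_singleton_eq_empty.2 hv, SimpleGraph.Subgraph.deleteVerts_empty]
  rw [← this]
  exact SimpleGraph.Subgraph.deleteVerts_mono h

/-- Whichever vertex is deleted, one of the two common vertices survives and joins the two connected
remainders. -/
theorem IsNonseparable.sup {B B' : G.Subgraph} (h : IsNonseparable B) (h' : IsNonseparable B')
    {u v : V} (huv : u ≠ v) (hu : u ∈ B.verts) (hv : v ∈ B.verts) (hu' : u ∈ B'.verts)
    (hv' : v ∈ B'.verts) : IsNonseparable (B ⊔ B') := by
  refine ⟨⟨u, Or.inl hu, v, Or.inl hv, huv⟩,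
    SimpleGraph.Subgraph.connected_sup h.2.1.preconnected h'.2.1.preconnected ⟨u, hu, hu'⟩, ?_⟩
  intro w _
  have hc : ∃ x, x ≠ w ∧ x ∈ B.verts ∧ x ∈ B'.verts := by
    by_cases huw : u = w
    · exact ⟨v, huw ▸ huv.symm, hv, hv'⟩
    · exact ⟨u, huw, hu, hu'⟩
  obtain ⟨x, hxw, hx, hx'⟩ := hc
  have := SimpleGraph.Subgraph.connected_sup (h.connected_deleteVerts w).preconnected
    (h'.connected_deleteVerts w).preconnected ⟨x, ⟨hx, hxw⟩, ⟨hx', hxw⟩⟩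
  refine this.mono (sup_le (SimpleGraph.Subgraph.deleteVerts_mono le_sup_left)
    (SimpleGraph.Subgraph.deleteVerts_mono le_sup_right)) ?_
  ext y
  simp only [SimpleGraph.Subgraph.verts_sup, SimpleGraph.Subgraph.deleteVerts_verts]
  grind

theorem IsBlock.eq_of_mem {B B' : G.Subgraph} (h : IsBlock B) (h' : IsBlock B')
    {u v : V} (huv : u ≠ v) (hu : u ∈ B.verts) (hv : v ∈ B.verts) (hu' : u ∈ B'.verts)
    (hv' : v ∈ B'.verts) : B = B' := by
  have hs := h.prop.sup h'.prop huv hu hv hu' hv'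
  exact le_antisymm (le_sup_left.trans (h'.le_of_ge hs le_sup_right))
    (le_sup_right.trans (h.le_of_ge hs le_sup_left))

/-- A path meets a deleted vertex `v` at most once, so from any other vertex of the path one of its
two halves reaches an end in `B` while avoiding `v`. -/
theorem IsNonseparable.sup_path {B : G.Subgraph} (h : IsNonseparable B) {a b : V}
    (ha : a ∈ B.verts) (hb : b ∈ B.verts) (hab : a ≠ b) (p : G.Walk a b) (hp : p.IsPath) :
    IsNonseparable (B ⊔ p.toSubgraph) := by
  classical
  refine ⟨⟨a, Or.inl ha, b, Or.inl hb, hab⟩,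
    SimpleGraph.Subgraph.connected_sup h.2.1.preconnected p.toSubgraph_connected.preconnected
      ⟨a, ha, p.start_mem_verts_toSubgraph⟩, ?_⟩
  intro v _
  refine connected_of_forall_exists_walk (h.connected_deleteVerts v)
    (SimpleGraph.Subgraph.deleteVerts_mono le_sup_left) ?_
  rintro x ⟨hx | hx, hxv⟩
  · refine ⟨x, ⟨hx, hxv⟩, .nil, ?_⟩
    rw [SimpleGraph.Walk.toSubgraph, SimpleGraph.singletonSubgraph_le_iff]
    exact ⟨Or.inl hx, hxv⟩
  · have hxs : x ∈ p.support := p.mem_verts_toSubgraph.1 hx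
    by_cases hv : v ∈ (p.takeUntil x hxs).support
    · have hv' : v ∉ (p.dropUntil x hxs).support := by
        intro hv'
        have hd := hp
        rw [← p.take_spec hxs, SimpleGraph.Walk.isPath_def, SimpleGraph.Walk.support_append,
          List.nodup_append] at hd
        rw [SimpleGraph.Walk.mem_support_iff] at hv'
        rcases hv' with hv' | hv'
        · exact hxv hv'.symm
        · exact hd.2.2 _ hv _ hv' rfl
      refine ⟨b, ⟨hb, ?_⟩, p.dropUntil x hxs, le_deleteVerts ?_ ?_⟩
      · rintro rfl
        exact hv' (SimpleGraph.Walk.end_mem_support _)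
      · refine le_trans ?_ le_sup_right
        conv_rhs => rw [← p.take_spec hxs]
        rw [SimpleGraph.Walk.toSubgraph_append]
        exact le_sup_right
      · rwa [SimpleGraph.Walk.mem_verts_toSubgraph]
    · refine ⟨a, ⟨ha, ?_⟩, (p.takeUntil x hxs).reverse, le_deleteVerts ?_ ?_⟩
      · rintro rfl
        exact hv (SimpleGraph.Walk.start_mem_support _)
      · refine le_trans ?_ le_sup_right
        conv_rhs => rw [← p.take_spec hxs]
        rw [SimpleGraph.Walk.toSubgraph_append, SimpleGraph.Walk.toSubgraph_reverse]
        exact le_sup_left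
      · rwa [SimpleGraph.Walk.mem_verts_toSubgraph, SimpleGraph.Walk.support_reverse,
          List.mem_reverse]

theorem IsBlock.toSubgraph_le {B : G.Subgraph} (h : IsBlock B) {a b : V}
    (ha : a ∈ B.verts) (hb : b ∈ B.verts) (hab : a ≠ b) (p : G.Walk a b) (hp : p.IsPath) :
    p.toSubgraph ≤ B :=
  le_sup_right.trans (h.le_of_ge (h.prop.sup_path ha hb hab p hp) le_sup_left)

/-- Any two vertices `x`, `y` are joined by a walk all of whose other vertices are closer to `v₀`
than `x` or `y`. -/
theorem exists_walk_dist_lt (hG : G.Connected) (v₀ x y : V) :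
    ∃ p : G.Walk x y, ∀ z ∈ p.support,
      z = x ∨ z = y ∨ G.dist v₀ z < G.dist v₀ x ∨ G.dist v₀ z < G.dist v₀ y := by
  classical
  have aux : ∀ x, ∃ p : G.Walk v₀ x, ∀ z ∈ p.support, z = x ∨ G.dist v₀ z < G.dist v₀ x := by
    intro x
    obtain ⟨p, hp⟩ := hG.exists_walk_length_eq_dist v₀ x
    refine ⟨p, fun z hz => ?_⟩
    by_cases hzx : z = x
    · exact Or.inl hzx
    · right
      rw [← hp]
      exact (SimpleGraph.dist_le _).trans_lt (p.length_takeUntil_lt_length hz hzx)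
  obtain ⟨p, hp⟩ := aux x
  obtain ⟨q, hq⟩ := aux y
  refine ⟨p.reverse.append q, fun z hz => ?_⟩
  rw [SimpleGraph.Walk.mem_support_append_iff, SimpleGraph.Walk.support_reverse,
    List.mem_reverse] at hz
  rcases hz with hz | hz
  · rcases hp z hz with h | h <;> simp [h]
  · rcases hq z hz with h | h <;> simp [h]

theorem exists_adj_dist_lt (hG : G.Connected) {v₀ v : V} (hv : v ≠ v₀) :
    ∃ u, G.Adj u v ∧ G.dist v₀ u < G.dist v₀ v := by
  obtain ⟨p, hp⟩ := hG.exists_walk_length_eq_dist v₀ v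
  have hn : ¬ p.Nil := fun h => hv h.eq.symm
  refine ⟨p.penultimate, p.adj_penultimate hn, ?_⟩
  have h1 := SimpleGraph.dist_le p.dropLast
  have h2 := SimpleGraph.Walk.length_dropLast_add_one hn
  omega

/-- A block has at most one vertex closest to a given vertex. -/
theorem IsBlock.dist_lt {B : G.Subgraph} (h : IsBlock B) (hG : G.Connected) (v₀ : V) {a b : V}
    (ha : a ∈ B.verts) (hb : b ∈ B.verts) (hab : a ≠ b)
    (hmin : ∀ c ∈ B.verts, G.dist v₀ a ≤ G.dist v₀ c) : G.dist v₀ a < G.dist v₀ b := by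
  classical
  refine lt_of_le_of_ne (hmin b hb) fun heq => ?_
  have ha0 : a ≠ v₀ := by
    rintro rfl
    rw [SimpleGraph.dist_self] at heq
    exact hab (hG.dist_eq_zero_iff.1 heq.symm)
  obtain ⟨u, hua, hu⟩ := exists_adj_dist_lt hG ha0
  obtain ⟨p, hp⟩ := exists_walk_dist_lt hG v₀ u b
  have hpa : a ∉ p.support := by
    intro hm
    rcases hp a hm with h | h | h | h
    · exact hua.ne h.symm
    · exact hab h
    · omega
    · omega
  -- If `b` were as close as `a`, going from `a` to a closer neighbour `u` and then to `b` would
  -- give a path between two vertices of the block. The block would then contain `u`, against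
  -- minimality.
  have hle := h.toSubgraph_le ha hb hab (.cons hua.symm p.bypass)
    ((SimpleGraph.Walk.cons_isPath_iff _ _).2
      ⟨p.bypass_isPath, fun h => hpa (p.support_bypass_subset_support h)⟩)
  have := hmin u (hle.1 (by simp))
  omega

/-- A vertex lies in only one block containing vertices closer to a given vertex. -/
theorem IsBlock.eq_of_dist_lt {B B' : G.Subgraph} (h : IsBlock B) (h' : IsBlock B')
    (hG : G.Connected) (v₀ : V) {v a u : V} (hv : v ∈ B.verts) (ha : a ∈ B.verts)
    (hav : G.dist v₀ a < G.dist v₀ v) (huv : B'.Adj u v) (hu : G.dist v₀ u < G.dist v₀ v) :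
    B = B' := by
  classical
  obtain ⟨p, hp⟩ := exists_walk_dist_lt hG v₀ a u
  have hpv : v ∉ p.support := by
    intro hm
    rcases hp v hm with h | h | h | h
    · subst h; omega
    · subst h; omega
    · omega
    · omega
  -- The path from `a` to `u` followed by the edge to `v` lies in `B`, so `B` and `B'` share both
  -- `u` and `v`.
  have hle := h.toSubgraph_le ha hv (by rintro rfl; omega) (p.bypass.concat huv.adj_sub)
    (p.bypass_isPath.concat (fun h => hpv (p.support_bypass_subset_support h)) _)
  exact h.eq_of_mem h' huv.adj_sub.ne (hle.1 (by simp)) hv (B'.edge_vert huv)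
    (B'.edge_vert huv.symm)

end Blocks

/-- `τ` records, for every gon `i` other than the root gon `r`, the type of the vertex of `i`
closest to `r`; `lab t i` is the label of the vertex of type `t` of the gon `i`. -/
structure IsEntryType {d : ℕ} {nn : Fin d → ℕ} {I : Type} (r : I) (lab : ∀ t : Fin d, I → Fin (nn t))
    (τ : I → Option (Fin d)) (rank : I → ℕ) : Prop where
  none_iff : ∀ i, τ i = none ↔ i = r
  existsUnique_head : ∀ t k, ∃! i, lab t i = k ∧ τ i ≠ some t
  rank_lt : ∀ t i j, lab t i = lab t j → τ i ≠ some t → τ j = some t → rank i < rank j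
  rank_eq : ∀ t i j, lab t i = lab t j → τ i = some t → τ j = some t → rank i = rank j

/-- The gons `I`, with root `r`, vertices given by `lab` and rotation around the vertices of type `t`
given by `σ t`, are arranged as in a cactus. -/
def IsTreeLike {d : ℕ} {nn : Fin d → ℕ} {I : Type} (r : I) (lab : ∀ t : Fin d, I → Fin (nn t))
    (σ : Fin d → I → I) : Prop :=
  (∀ t i j, lab t i = lab t j ↔ ∃ k, (σ t)^[k] i = j) ∧ ∃ τ rank, IsEntryType r lab τ rank

/-! ### Gons of a `d`-graph, their labels and entry vertices -/

section DGraph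

variable {d : ℕ} {nn : Fin d → ℕ} {G : SimpleGraph (Vertex nn)}

theorem IsTypedCycle.existsUnique_mem {B : G.Subgraph} (h : IsTypedCycle B) (t : Fin d) :
    ∃! k, (⟨t, k⟩ : Vertex nn) ∈ B.verts := by
  obtain ⟨f, hf⟩ := h
  have key : ∀ v : Vertex nn, v ∈ B.verts → v = f v.1 := by
    intro v hv
    have h1 := hf (f.symm ⟨v, hv⟩)
    rw [f.apply_symm_apply] at h1
    simp only at h1
    rw [h1, f.apply_symm_apply]
  obtain ⟨⟨s, k⟩, hx⟩ : ∃ x, x = (f t : Vertex nn) := ⟨_, rfl⟩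
  obtain rfl : s = t := by rw [← hf t, ← hx]
  refine ⟨k, by simpa only [← hx] using (f s).2, fun k' hk' => ?_⟩
  have h1 := (key _ hk').trans hx.symm
  simpa using h1

theorem IsTypedCycle.adj_iff {B : G.Subgraph} (h : IsTypedCycle B) (u v : Vertex nn) :
    B.Adj u v ↔ u ∈ B.verts ∧ v ∈ B.verts ∧ (SimpleGraph.cycleGraph d).Adj u.1 v.1 := by
  obtain ⟨f, hf⟩ := h
  have key : ∀ v : Vertex nn, ∀ hv : v ∈ B.verts, f.symm ⟨v, hv⟩ = v.1 := by
    intro v hv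
    have h1 := hf (f.symm ⟨v, hv⟩)
    rw [f.apply_symm_apply] at h1
    exact h1.symm
  constructor
  · intro hB
    refine ⟨B.edge_vert hB, B.edge_vert hB.symm, ?_⟩
    rw [← key u (B.edge_vert hB), ← key v (B.edge_vert hB.symm), f.symm.map_adj_iff]
    exact hB
  · rintro ⟨hu, hv, huv⟩
    rw [← key u hu, ← key v hv, f.symm.map_adj_iff] at huv
    exact huv

/-- The label of the vertex of type `t` of a gon. -/
noncomputable def gonLabel (hG : IsDGraph G) (g : Gon G) (t : Fin d) : Fin (nn t) :=
  ((hG.2 g.1 g.2).existsUnique_mem t).choose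

theorem mem_gon_iff (hG : IsDGraph G) (g : Gon G) (v : Vertex nn) :
    v ∈ g.1.verts ↔ gonLabel hG g v.1 = v.2 := by
  have h := ((hG.2 g.1 g.2).existsUnique_mem v.1).choose_spec
  constructor
  · intro hv
    exact (h.2 v.2 hv).symm
  · intro hv
    have h1 := h.1
    change (⟨v.1, gonLabel hG g v.1⟩ : Vertex nn) ∈ g.1.verts at h1
    rw [hv] at h1
    exact h1

theorem gonLabel_mem (hG : IsDGraph G) (g : Gon G) (t : Fin d) :
    (⟨t, gonLabel hG g t⟩ : Vertex nn) ∈ g.1.verts :=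
  (mem_gon_iff hG g _).2 rfl

theorem IsDGraph.adj_iff (hG : IsDGraph G) (u v : Vertex nn) :
    G.Adj u v ↔ ∃ g : Gon G, gonLabel hG g u.1 = u.2 ∧ gonLabel hG g v.1 = v.2 ∧
      (SimpleGraph.cycleGraph d).Adj u.1 v.1 := by
  constructor
  · intro h
    obtain ⟨B, hB, huv⟩ := exists_isBlock_adj h
    refine ⟨⟨B, hB⟩, ?_⟩
    rw [(hG.2 B hB).adj_iff] at huv
    rwa [← mem_gon_iff, ← mem_gon_iff]
  · rintro ⟨g, hg⟩
    rw [← mem_gon_iff, ← mem_gon_iff, ← (hG.2 g.1 g.2).adj_iff] at hg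
    exact hg.adj_sub

/-- Labels give the vertex set, and blocks sharing two vertices coincide. -/
theorem Gon.eq_of_gonLabel_eq (hG : IsDGraph G) {g g' : Gon G}
    (h : ∀ t, gonLabel hG g t = gonLabel hG g' t) : g = g' := by
  have hv : ∀ v, v ∈ g.1.verts ↔ v ∈ g'.1.verts := fun v => by
    rw [mem_gon_iff hG, mem_gon_iff hG, h]
  obtain ⟨u, hu, v, hv', huv⟩ := g.2.prop.1
  exact Subtype.ext (g.2.eq_of_mem g'.2 huv hu hv' ((hv u).1 hu) ((hv v).1 hv'))

/-- Distances are taken from a vertex `v₀` of the root gon. A gon is entered through its unique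
vertex closest to `v₀`. Its rank is that distance plus one, which leaves rank 0 to the root gon
alone, even below the gons entered through `v₀`. -/
theorem IsDGraph.exists_isEntryType (hG : IsDGraph G) {I : Type} (e : I ≃ Gon G) (r : I) :
    ∃ τ rank, IsEntryType r (fun t i => gonLabel hG (e i) t) τ rank := by
  classical
  obtain ⟨v₀, hv₀⟩ := (e r).2.prop.1.nonempty
  have hmin : ∀ i, ∃ a ∈ (e i).1.verts, ∀ c ∈ (e i).1.verts, G.dist v₀ a ≤ G.dist v₀ c :=
    fun i => Set.exists_min_image _ _ (Set.toFinite _) (e i).2.prop.1.nonempty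
  choose a ha ham using hmin
  have hlt : ∀ i, ∀ v ∈ (e i).1.verts, a i ≠ v → G.dist v₀ (a i) < G.dist v₀ v :=
    fun i v hv h => (e i).2.dist_lt hG.1 v₀ (ha i) hv h (ham i)
  have hmem : ∀ i (v : Vertex nn), gonLabel hG (e i) v.1 = v.2 → (a i).1 = v.1 → a i = v := by
    intro i v h1 h2
    have h3 := (mem_gon_iff hG _ _).1 (ha i)
    generalize a i = b at *
    obtain ⟨t, k⟩ := v
    obtain ⟨t', k'⟩ := b
    simp only at h1 h2 h3
    subst h2
    rw [← h1, ← h3]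
  have hne : ∀ i, i ≠ r → ∀ t, (if i = r then none else some (a i).1) = some t → (a i).1 = t := by
    intro i hi t h
    rw [if_neg hi] at h
    exact Option.some.inj h
  refine ⟨fun i => if i = r then none else some (a i).1,
    fun i => if i = r then 0 else G.dist v₀ (a i) + 1, ?_, ?_, ?_, ?_⟩
  · intro i
    simp
  · intro t k
    by_cases hv : (⟨t, k⟩ : Vertex nn) = v₀
    · subst hv
      refine ⟨r, ⟨(mem_gon_iff hG _ _).1 hv₀, by simp⟩, ?_⟩
      rintro j ⟨hj, hjt⟩
      by_contra hjr
      simp only [if_neg hjr] at hjt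
      refine hjt (congrArg some ?_)
      by_contra hne
      have := hlt j ⟨t, k⟩ ((mem_gon_iff hG _ _).2 hj) (fun h => hne (h ▸ rfl))
      simp at this
    · obtain ⟨u, huv, hu⟩ := exists_adj_dist_lt hG.1 hv
      obtain ⟨B, hB, hBuv⟩ := exists_isBlock_adj huv
      obtain ⟨i, hi⟩ := e.surjective ⟨B, hB⟩
      have hi' : (e i).1 = B := by rw [hi]
      have hlab := (mem_gon_iff hG (e i) ⟨t, k⟩).1 (hi' ▸ B.edge_vert hBuv.symm)
      refine ⟨i, ⟨hlab, ?_⟩, ?_⟩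
      · intro h
        by_cases hir : i = r
        · simp [hir] at h
        · have h1 := hmem i ⟨t, k⟩ hlab (hne i hir t h)
          have h2 := ham i u (hi' ▸ B.edge_vert hBuv)
          rw [h1] at h2
          omega
      · rintro j ⟨hj, hjt⟩
        have hjv := (mem_gon_iff hG (e j) ⟨t, k⟩).2 hj
        -- A gon at `v` not entered through `v` has a vertex closer to `v₀`, and only one block at
        -- `v` has such a vertex.
        have hlt' : ∃ x ∈ (e j).1.verts, G.dist v₀ x < G.dist v₀ ⟨t, k⟩ := by
          by_cases hjr : j = r
          · refine ⟨v₀, hjr ▸ hv₀, ?_⟩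
            rw [SimpleGraph.dist_self]
            exact hG.1.pos_dist_of_ne (Ne.symm hv)
          · refine ⟨a j, ha j, hlt j _ hjv ?_⟩
            intro h
            simp only [if_neg hjr] at hjt
            exact hjt (by rw [h])
        obtain ⟨x, hx, hxv⟩ := hlt'
        have := (e j).2.eq_of_dist_lt hB hG.1 v₀ hjv hx hxv hBuv hu
        exact e.injective (Subtype.ext (this.trans hi'.symm))
  · intro t i j hij hi hj
    have hjr : j ≠ r := by rintro rfl; simp at hj
    have hjv := hmem j ⟨t, gonLabel hG (e j) t⟩ rfl (hne j hjr t hj)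
    simp only [if_neg hjr]
    by_cases hir : i = r
    · simp [hir]
    · simp only [if_neg hir]
      have := hlt i (a j) ?_ ?_
      · omega
      · rw [hjv]
        exact (mem_gon_iff hG _ _).2 hij
      · intro h
        simp only [if_neg hir] at hi
        apply hi
        rw [h, hjv]
  · intro t i j hij hi hj
    have hjr : j ≠ r := by rintro rfl; simp at hj
    have hir : i ≠ r := by rintro rfl; simp at hi
    have hjv := hmem j ⟨t, gonLabel hG (e j) t⟩ rfl (hne j hjr t hj)
    have hiv := hmem i ⟨t, gonLabel hG (e j) t⟩ hij (hne i hir t hi)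
    simp only [if_neg hjr, if_neg hir]
    rw [hjv, hiv]

end DGraph

/-! ### Rotations as maps on all gons -/

section Rotation

variable {d : ℕ} {nn : Fin d → ℕ}

/-- The next gon around the vertex of type `t` of a gon. -/
noncomputable def nextGon (C : LabeledCactus nn) (t : Fin d) (g : Gon C.graph) : Gon C.graph :=
  (C.next ⟨t, gonLabel C.isDGraph g t⟩ ⟨g, gonLabel_mem C.isDGraph g t⟩).1

theorem nextGon_eq (C : LabeledCactus nn) (v : Vertex nn) (g : GonAt C.graph v) :
    nextGon C v.1 g.1 = (C.next v g).1 := by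
  obtain ⟨t, k⟩ := v
  obtain ⟨g, hg⟩ := g
  have h := (mem_gon_iff C.isDGraph g _).1 hg
  simp only at h
  subst h
  rfl

theorem nextGon_iterate (C : LabeledCactus nn) (v : Vertex nn) (g : GonAt C.graph v) (k : ℕ) :
    (nextGon C v.1)^[k] g.1 = (((C.next v) ^ k) g).1 := by
  induction k with
  | zero => rfl
  | succ k ih =>
    rw [Function.iterate_succ_apply', ih, nextGon_eq, pow_succ', Equiv.Perm.mul_apply]

theorem gonLabel_eq_iff (C : LabeledCactus nn) (t : Fin d) (g h : Gon C.graph) :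
    gonLabel C.isDGraph g t = gonLabel C.isDGraph h t ↔ ∃ k, (nextGon C t)^[k] g = h := by
  constructor
  · intro hgh
    set v : Vertex nn := ⟨t, gonLabel C.isDGraph g t⟩ with hv
    have hg : g ∈ {g : Gon C.graph | v ∈ g.1.verts} := gonLabel_mem C.isDGraph g t
    have hh : v ∈ h.1.verts := (mem_gon_iff C.isDGraph h v).2 hgh.symm
    obtain ⟨k, hk⟩ := ((C.next_isCycleOn v).2 (Set.mem_univ (⟨g, hg⟩ : GonAt C.graph v))
      (Set.mem_univ ⟨h, hh⟩)).exists_nat_pow_eq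
    refine ⟨k, ?_⟩
    have := nextGon_iterate C v ⟨g, hg⟩ k
    rw [hk] at this
    exact this
  · rintro ⟨k, rfl⟩
    set v : Vertex nn := ⟨t, gonLabel C.isDGraph g t⟩ with hv
    have := nextGon_iterate C v ⟨g, gonLabel_mem C.isDGraph g t⟩ k
    simp only [hv] at this
    rw [this]
    exact ((mem_gon_iff C.isDGraph _ v).1 (((C.next v) ^ k) ⟨g, gonLabel_mem C.isDGraph g t⟩).2).symm

end Rotation

/-! ### Encoding a cactus by root, labels and rotations -/

section Datum

variable {d : ℕ} {nn : Fin d → ℕ} {I : Type}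

/-- The root, vertices and rotations of a cactus whose gons are labelled by `I`. -/
noncomputable def toDatum (x : Σ C : RootedLabeledCactus nn, I ≃ Gon C.graph) :
    I × (∀ t : Fin d, I → Fin (nn t)) × (Fin d → I → I) :=
  (x.2.symm x.1.root, fun t i => gonLabel x.1.isDGraph (x.2 i) t,
    fun t i => x.2.symm (nextGon x.1.toLabeledCactus t (x.2 i)))

theorem isTreeLike_toDatum (x : Σ C : RootedLabeledCactus nn, I ≃ Gon C.graph) :
    IsTreeLike (toDatum x).1 (toDatum x).2.1 (toDatum x).2.2 := by
  refine ⟨fun t i j => ?_, x.1.isDGraph.exists_isEntryType x.2 _⟩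
  refine (gonLabel_eq_iff x.1.toLabeledCactus t (x.2 i) (x.2 j)).trans ?_
  refine exists_congr fun k => ?_
  have : Function.Semiconj x.2.symm (nextGon x.1.toLabeledCactus t)
      (fun i => x.2.symm (nextGon x.1.toLabeledCactus t (x.2 i))) := fun g => by simp
  have h2 := (this.iterate_right k).eq (x.2 i)
  rw [x.2.symm_apply_apply] at h2
  change _ ↔ (fun i => x.2.symm (nextGon x.1.toLabeledCactus t (x.2 i)))^[k] i = j
  rw [← h2, Equiv.symm_apply_eq]

/-- Labels recover adjacency (a common gon and cyclically adjacent types), hence the graph. They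
also recover each gon, hence the numbering `e`; the root and the rotations follow. -/
theorem toDatum_injective : Function.Injective (toDatum (nn := nn) (I := I)) := by
  rintro ⟨⟨⟨G, hG, next, hn⟩, root⟩, e⟩ ⟨⟨⟨G', hG', next', hn'⟩, root'⟩, e'⟩ h
  simp only [toDatum, Prod.mk.injEq] at h
  obtain ⟨h1, h2, h3⟩ := h
  have h2' : ∀ t i, gonLabel hG (e i) t = gonLabel hG' (e' i) t := fun t i =>
    congrFun (congrFun h2 t) i
  have hGG : G = G' := by
    ext u v
    rw [hG.adj_iff, hG'.adj_iff, ← e.exists_congr_right, ← e'.exists_congr_right]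
    simp only [h2']
  subst hGG
  have hee : e = e' := Equiv.ext fun i => Gon.eq_of_gonLabel_eq hG fun t => h2' t i
  subst hee
  have hr : root = root' := e.symm.injective h1
  subst hr
  have hnn : next = next' := by
    funext v
    ext1 g
    have h4 := congrFun (congrFun h3 v.1) (e.symm g.1)
    rw [e.apply_symm_apply] at h4
    have h5 := e.symm.injective h4
    rw [nextGon_eq ⟨G, hG, next, hn⟩ v g, nextGon_eq ⟨G, hG, next', hn'⟩ v g] at h5
    exact Subtype.ext h5
  subst hnn
  rfl

end Datum

/-! ### Rebuilding a cactus from its encoding -/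

section GonGraph

variable {d : ℕ} {nn : Fin d → ℕ} {I : Type}

/-- The union of the typed cycles with vertices `⟨t, lab t i⟩`. -/
def gonGraph (lab : ∀ t : Fin d, I → Fin (nn t)) : SimpleGraph (Vertex nn) where
  Adj u v := ∃ i, lab u.1 i = u.2 ∧ lab v.1 i = v.2 ∧ (SimpleGraph.cycleGraph d).Adj u.1 v.1
  symm := ⟨fun _ _ ⟨i, hu, hv, h⟩ => ⟨i, hv, hu, h.symm⟩⟩
  loopless := ⟨fun _ ⟨_, _, _, h⟩ => h.ne rfl⟩

/-- The typed cycle with vertices `⟨t, lab t i⟩`. -/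
def gonSubgraph (lab : ∀ t : Fin d, I → Fin (nn t)) (i : I) : (gonGraph lab).Subgraph where
  verts := {v | lab v.1 i = v.2}
  Adj u v := lab u.1 i = u.2 ∧ lab v.1 i = v.2 ∧ (SimpleGraph.cycleGraph d).Adj u.1 v.1
  adj_sub h := ⟨i, h⟩
  edge_vert h := h.1
  symm := ⟨fun _ _ ⟨hu, hv, h⟩ => ⟨hv, hu, h.symm⟩⟩

theorem isTypedCycle_gonSubgraph (lab : ∀ t : Fin d, I → Fin (nn t)) (i : I) :
    IsTypedCycle (gonSubgraph lab i) := by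
  refine ⟨⟨⟨fun t => ⟨⟨t, lab t i⟩, rfl⟩, fun v => v.1.1, fun t => rfl, ?_⟩, ?_⟩, fun t => rfl⟩
  · rintro ⟨⟨t, k⟩, hk⟩
    simp only [gonSubgraph, Set.mem_ofPred_eq] at hk
    subst hk
    rfl
  · intro s t
    exact ⟨fun h => h.2.2, fun h => ⟨rfl, rfl, h⟩⟩

theorem isNonseparable_gonSubgraph (hd : 2 ≤ d) (lab : ∀ t : Fin d, I → Fin (nn t)) (i : I) :
    IsNonseparable (gonSubgraph lab i) := by
  obtain ⟨m, rfl⟩ := Nat.exists_eq_add_of_le' hd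
  refine ⟨⟨⟨0, lab 0 i⟩, rfl, ⟨1, lab 1 i⟩, rfl, ?_⟩, ?_, ?_⟩
  · intro h
    have := congrArg Sigma.fst h
    simp at this
  · obtain ⟨f, -⟩ := isTypedCycle_gonSubgraph lab i
    exact ⟨(SimpleGraph.Iso.connected_iff f).1 (SimpleGraph.cycleGraph_connected (n := m + 1))⟩
  · intro v hv
    have hne : ∀ j : Fin (m + 1), v.1 + 1 + j.castSucc ≠ v.1 := by
      intro j h
      rw [add_assoc, add_eq_left, Fin.ext_iff, Fin.val_add, Fin.val_one, Fin.val_castSucc,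
        Nat.mod_eq_of_lt (by omega), Fin.val_zero] at h
      omega
    -- A cycle minus a vertex is a path; it is numbered starting from the type following that of
    -- `v`.
    let f : SimpleGraph.pathGraph (m + 1) →g ((gonSubgraph lab i).deleteVerts {v}).coe :=
      { toFun := fun j => ⟨⟨v.1 + 1 + j.castSucc, lab _ i⟩, rfl,
          fun h => hne j (congrArg Sigma.fst h)⟩
        map_rel' := by
          intro a b hab
          rw [SimpleGraph.pathGraph_adj] at hab
          refine SimpleGraph.Subgraph.deleteVerts_adj.2 ⟨rfl, fun h => hne a (congrArg Sigma.fst h),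
            rfl, fun h => hne b (congrArg Sigma.fst h), rfl, rfl, ?_⟩
          rw [SimpleGraph.cycleGraph_adj]
          simp only [add_sub_add_left_eq_sub]
          rcases hab with hab | hab
          · right
            rw [sub_eq_iff_eq_add]
            rw [Fin.ext_iff, Fin.val_add, Fin.val_one, Fin.val_castSucc, Fin.val_castSucc,
              Nat.mod_eq_of_lt (by omega)]
            omega
          · left
            rw [sub_eq_iff_eq_add]
            rw [Fin.ext_iff, Fin.val_add, Fin.val_one, Fin.val_castSucc, Fin.val_castSucc,
              Nat.mod_eq_of_lt (by omega)]
            omega }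
    have hf : Function.Surjective f := by
      rintro ⟨⟨t, k⟩, hk, htv⟩
      change lab t i = k at hk
      subst hk
      have htv' : t ≠ v.1 := by
        rintro rfl
        exact htv (Sigma.ext rfl (heq_of_eq hv))
      have hlast : t - v.1 - 1 ≠ Fin.last (m + 1) := by
        rw [ne_eq, sub_eq_iff_eq_add, Fin.last_add_one, sub_eq_zero]
        exact htv'
      obtain ⟨j, hj⟩ := Fin.exists_castSucc_eq.2 hlast
      refine ⟨j, Subtype.ext ?_⟩
      have : v.1 + 1 + j.castSucc = t := by
        rw [hj]
        abel
      change (⟨v.1 + 1 + j.castSucc, lab _ i⟩ : Vertex nn) = ⟨t, lab t i⟩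
      rw [this]
    exact ⟨SimpleGraph.Connected.map f hf (SimpleGraph.pathGraph_connected m)⟩

theorem Connected.verts_subset {V : Type} {G : SimpleGraph V} {K : G.Subgraph} (hK : K.Connected)
    {S : Set V} {w : V} (hw : w ∈ K.verts) (hwS : w ∈ S)
    (hS : ∀ x ∈ S, ∀ y, K.Adj x y → y ∈ S) : K.verts ⊆ S := by
  intro y hy
  rw [SimpleGraph.Subgraph.connected_iff_forall_exists_walk_subgraph] at hK
  obtain ⟨p, hp⟩ := hK.2 hw hy
  clear hw hy
  induction p with
  | nil => exact hwS
  | cons h p ih =>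
    rw [SimpleGraph.Walk.toSubgraph, sup_le_iff] at hp
    exact ih (hS _ hwS _ (hp.1.2 (by simp))) hp.2

variable {r : I} {lab : ∀ t : Fin d, I → Fin (nn t)} {τ : I → Option (Fin d)} {rank : I → ℕ}

/-- A gon not entered through its vertex of type `t` is the head there, so every other gon at that
vertex is entered through it and ranks higher. -/
theorem IsEntryType.eq_or (h : IsEntryType r lab τ rank) {t : Fin d} {i j : I}
    (hij : lab t i = lab t j) (hi : τ i ≠ some t) : j = i ∨ τ j = some t ∧ rank i < rank j := by
  by_cases hj : τ j = some t
  · exact Or.inr ⟨hj, h.rank_lt t i j hij hi hj⟩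
  · exact Or.inl ((h.existsUnique_head t (lab t i)).unique ⟨hij.symm, hj⟩ ⟨rfl, hi⟩)

/-- A vertex common to two distinct gons is the entry of one of them. If two types are shared, each
gon is entered through one of the two vertices, and the ranks contradict each other. -/
theorem IsEntryType.eq_of_lab_eq (h : IsEntryType r lab τ rank) (hd : 2 ≤ d) {i j : I}
    (hij : ∀ t, lab t i = lab t j) : i = j := by
  by_contra hne
  have h1 : ∀ t, τ i = some t ∨ τ j = some t := by
    intro t
    by_cases hi : τ i = some t
    · exact Or.inl hi
    · rcases h.eq_or (hij t) hi with rfl | hj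
      · exact absurd rfl hne
      · exact Or.inr hj.1
  have h01 : (⟨0, by omega⟩ : Fin d) ≠ ⟨1, by omega⟩ := by simp
  have key : ∀ s t : Fin d, s ≠ t → τ i = some s → τ j = some t → False := by
    intro s t hst hs ht
    have := h.rank_lt t i j (hij t) (by rw [hs]; simpa using hst) ht
    have := h.rank_lt s j i (hij s).symm (by rw [ht]; simpa using hst.symm) hs
    omega
  rcases h1 ⟨0, by omega⟩ with h0 | h0 <;> rcases h1 ⟨1, by omega⟩ with h2 | h2
  · rw [h0] at h2; simp at h2
  · exact key _ _ h01 h0 h2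
  · exact key _ _ h01.symm h2 h0
  · rw [h0] at h2; simp at h2

/-- Among the gons sharing an edge with `H`, take one of greatest rank, `i`. At a vertex of `i`
other than its entry, all other gons rank higher, so every edge of `H` there stays in `i`. Hence `H`
can leave `i` only through the entry vertex, and deleting that vertex keeps `H` connected. -/
theorem IsEntryType.exists_le_gonSubgraph [Finite I] (h : IsEntryType r lab τ rank)
    {H : (gonGraph lab).Subgraph} (hH : IsNonseparable H) : ∃ i, H ≤ gonSubgraph lab i := by
  have hex : {i | ∃ u v, H.Adj u v ∧ (gonSubgraph lab i).Adj u v}.Nonempty := by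
    have : Nontrivial H.verts := Set.nontrivial_coe_sort.2 hH.1
    obtain ⟨u, hu⟩ := hH.1.nonempty
    obtain ⟨v, huv⟩ := hH.2.1.preconnected.exists_adj_of_nontrivial ⟨u, hu⟩
    obtain ⟨i, hi⟩ := huv.adj_sub
    exact ⟨i, _, _, huv, hi⟩
  obtain ⟨i, ⟨u, v, huv, hiuv⟩, hmax⟩ := Set.exists_max_image _ rank (Set.toFinite _) hex
  have hS : ∀ x, lab x.1 i = x.2 → τ i ≠ some x.1 → ∀ y, H.Adj x y → lab y.1 i = y.2 := by
    intro x hx hxi y hxy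
    obtain ⟨j, hj⟩ := hxy.adj_sub
    rcases h.eq_or (hx.trans hj.1.symm) hxi with rfl | hlt
    · exact hj.2.1
    · have := hmax j ⟨x, y, hxy, hj⟩
      omega
  obtain ⟨w, hw, hwi, hwτ⟩ : ∃ w ∈ H.verts, lab w.1 i = w.2 ∧ τ i ≠ some w.1 := by
    by_cases hu : τ i = some u.1
    · refine ⟨v, H.edge_vert huv.symm, hiuv.2.1, fun hv => ?_⟩
      rw [hu] at hv
      exact hiuv.2.2.ne (Option.some.inj hv)
    · exact ⟨u, H.edge_vert huv, hiuv.1, hu⟩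
  obtain ⟨K, hK, hKH, hKv⟩ : ∃ K : (gonGraph lab).Subgraph, K.Connected ∧ K ≤ H ∧
      ∀ x, x ∈ K.verts ↔ x ∈ H.verts ∧ ¬ (lab x.1 i = x.2 ∧ τ i = some x.1) := by
    cases hτ : τ i with
    | none => exact ⟨H, hH.2.1, le_rfl, fun x => by simp⟩
    | some t =>
      refine ⟨H.deleteVerts {⟨t, lab t i⟩}, hH.connected_deleteVerts _,
        SimpleGraph.Subgraph.deleteVerts_le, fun x => ?_⟩
      obtain ⟨s, k⟩ := x
      simp only [SimpleGraph.Subgraph.deleteVerts_verts, Set.mem_sdiff, Set.mem_singleton_iff,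
        Option.some.injEq]
      refine and_congr_right fun _ => not_congr ⟨?_, ?_⟩
      · intro h
        cases h
        exact ⟨rfl, rfl⟩
      · rintro ⟨h1, rfl⟩
        rw [h1]
  have hsub := Connected.verts_subset hK (S := {x | lab x.1 i = x.2 ∧ τ i ≠ some x.1})
    ((hKv w).2 ⟨hw, fun h => hwτ h.2⟩) ⟨hwi, hwτ⟩ (by
      rintro x ⟨hx, hxi⟩ y hxy
      have hy := hS x hx hxi y (hKH.2 hxy)
      exact ⟨hy, fun hyτ => ((hKv y).1 (K.edge_vert hxy.symm)).2 ⟨hy, hyτ⟩⟩)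
  have hverts : ∀ x ∈ H.verts, lab x.1 i = x.2 := by
    intro x hx
    by_contra hxi
    exact hxi (hsub ((hKv x).2 ⟨hx, fun h => hxi h.1⟩)).1
  refine ⟨i, hverts, fun x y hxy => ?_⟩
  obtain ⟨j, hj⟩ := hxy.adj_sub
  exact ⟨hverts x (H.edge_vert hxy), hverts y (H.edge_vert hxy.symm), hj.2.2⟩

theorem IsEntryType.isBlock_iff [Finite I] (h : IsEntryType r lab τ rank) (hd : 2 ≤ d)
    {H : (gonGraph lab).Subgraph} : IsBlock H ↔ ∃ i, gonSubgraph lab i = H := by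
  constructor
  · intro hH
    obtain ⟨i, hi⟩ := h.exists_le_gonSubgraph hH.prop
    exact ⟨i, le_antisymm (hH.le_of_ge (isNonseparable_gonSubgraph hd lab i) hi) hi⟩
  · rintro ⟨i, rfl⟩
    refine ⟨isNonseparable_gonSubgraph hd lab i, fun K hK hle => ?_⟩
    obtain ⟨j, hj⟩ := h.exists_le_gonSubgraph hK
    have : i = j := h.eq_of_lab_eq hd fun t => by
      have := (hle.trans hj).1 (show (⟨t, lab t i⟩ : Vertex nn) ∈ (gonSubgraph lab i).verts from rfl)
      exact this.symm
    exact this ▸ hj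

/-- Passing from a gon to the head at its entry vertex lowers the rank, so it ends at `r`. -/
theorem IsEntryType.connected_gonGraph (h : IsEntryType r lab τ rank) (hd : 2 ≤ d) :
    (gonGraph lab).Connected := by
  have hB : ∀ i u v, lab u.1 i = u.2 → lab v.1 i = v.2 → (gonGraph lab).Reachable u v := by
    intro i u v hu hv
    have := (isNonseparable_gonSubgraph hd lab i).2.1
    rw [SimpleGraph.Subgraph.connected_iff_forall_exists_walk_subgraph] at this
    obtain ⟨p, -⟩ := this.2 hu hv
    exact ⟨p⟩
  let t₀ : Fin d := ⟨0, by omega⟩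
  have key : ∀ n i, rank i = n → ∀ v : Vertex nn, lab v.1 i = v.2 →
      (gonGraph lab).Reachable ⟨t₀, lab t₀ r⟩ v := by
    intro n
    induction n using Nat.strong_induction_on with
    | _ n ih =>
      intro i hi v hv
      cases hτ : τ i with
      | none =>
        obtain rfl := (h.none_iff i).1 hτ
        exact hB i _ v rfl hv
      | some t =>
        obtain ⟨j, ⟨hj, hjt⟩, -⟩ := h.existsUnique_head t (lab t i)
        have hlt := h.rank_lt t j i hj hjt hτ
        exact (ih (rank j) (hi ▸ hlt) j rfl ⟨t, lab t i⟩ hj).trans (hB i _ v rfl hv)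
  have : Nonempty (Vertex nn) := ⟨⟨t₀, lab t₀ r⟩⟩
  have hr : ∀ v, (gonGraph lab).Reachable ⟨t₀, lab t₀ r⟩ v := by
    intro v
    obtain ⟨i, hi, -⟩ := h.existsUnique_head v.1 v.2
    exact key _ i rfl v hi.1
  exact ⟨fun u v => (hr u).symm.trans (hr v)⟩

theorem IsEntryType.isDGraph [Finite I] (h : IsEntryType r lab τ rank) (hd : 2 ≤ d) :
    IsDGraph (gonGraph lab) := by
  refine ⟨h.connected_gonGraph hd, fun B hB => ?_⟩
  obtain ⟨i, rfl⟩ := (h.isBlock_iff hd).1 hB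
  exact isTypedCycle_gonSubgraph lab i

/-- The gons of `gonGraph lab` are the typed cycles it is made of. -/
noncomputable def IsEntryType.gonEquiv [Finite I] (h : IsEntryType r lab τ rank) (hd : 2 ≤ d) :
    I ≃ Gon (gonGraph lab) :=
  Equiv.ofBijective (fun i => ⟨gonSubgraph lab i, (h.isBlock_iff hd).2 ⟨i, rfl⟩⟩) <| by
    refine ⟨fun i j hij => h.eq_of_lab_eq hd fun t => ?_, fun g => ?_⟩
    · have hij' : gonSubgraph lab i = gonSubgraph lab j := congrArg Subtype.val hij
      have : (⟨t, lab t i⟩ : Vertex nn) ∈ (gonSubgraph lab i).verts := rfl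
      rw [hij'] at this
      exact this.symm
    · obtain ⟨i, hi⟩ := (h.isBlock_iff hd).1 g.2
      exact ⟨i, Subtype.ext hi⟩

/-- Since `f (s i) = f i`, iterating `s` leads from `s i` back to `i`; hence `s` is surjective on
each fibre, and bijective by finiteness. -/
theorem exists_perm_fiber {α β : Type} [Finite α] {f : α → β} {s : α → α}
    (hs : ∀ i j, f i = f j ↔ ∃ k, s^[k] i = j) (b : β) :
    ∃ p : Equiv.Perm {i // f i = b}, (∀ x, (p x).1 = s x.1) ∧ p.IsCycleOn Set.univ := by
  have hf : ∀ i, f (s i) = f i := fun i => ((hs i (s i)).2 ⟨1, rfl⟩).symm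
  let g : {i // f i = b} → {i // f i = b} := fun x => ⟨s x.1, (hf x.1).trans x.2⟩
  have hg : ∀ k x, (g^[k] x).1 = s^[k] x.1 := by
    intro k x
    induction k with
    | zero => rfl
    | succ k ih => rw [Function.iterate_succ_apply', Function.iterate_succ_apply', ← ih]
  have hsurj : Function.Surjective g := by
    intro x
    obtain ⟨k, hk⟩ := (hs (s x.1) x.1).1 (hf x.1)
    refine ⟨g^[k] x, Subtype.ext ?_⟩
    change s (g^[k] x).1 = x.1
    rw [hg, ← Function.iterate_succ_apply' s, Function.iterate_succ_apply, hk]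
  refine ⟨Equiv.ofBijective g (Finite.injective_iff_bijective.1
    (Finite.injective_iff_surjective.2 hsurj)), fun x => rfl, ?_⟩
  refine ⟨Set.bijOn_univ.2 (Equiv.bijective _), fun x _ y _ => ?_⟩
  obtain ⟨k, hk⟩ := (hs x.1 y.1).1 (x.2.trans y.2.symm)
  refine ⟨k, Subtype.ext ?_⟩
  rw [zpow_natCast, Equiv.Perm.coe_pow]
  exact (hg k x).trans hk

theorem isCycleOn_univ_permCongr {α β : Type} (e : α ≃ β) {p : Equiv.Perm α}
    (hp : p.IsCycleOn Set.univ) : (e.permCongr p).IsCycleOn Set.univ := by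
  refine ⟨Set.bijOn_univ.2 (Equiv.bijective _), fun x _ y _ => ?_⟩
  obtain ⟨k, hk⟩ := hp.2 (Set.mem_univ (e.symm x)) (Set.mem_univ (e.symm y))
  refine ⟨k, ?_⟩
  have : (e.permCongr p) ^ k = e.permCongr (p ^ k) := (map_zpow e.permCongrHom p k).symm
  rw [this, Equiv.permCongr_apply, hk, e.apply_symm_apply]

theorem exists_toDatum_eq [Finite I] (hd : 2 ≤ d) {σ : Fin d → I → I} (h : IsTreeLike r lab σ) :
    ∃ x, toDatum x = (r, lab, σ) := by
  obtain ⟨hσ, τ, rank, h⟩ := h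
  choose p hp hpc using fun v : Vertex nn => exists_perm_fiber (hσ v.1) v.2
  let F : ∀ v : Vertex nn, {i // lab v.1 i = v.2} ≃ GonAt (gonGraph lab) v := fun v =>
    (h.gonEquiv hd).subtypeEquiv fun i => Iff.rfl
  let C : LabeledCactus nn :=
    { graph := gonGraph lab
      isDGraph := h.isDGraph hd
      next := fun v => (F v).permCongr (p v)
      next_isCycleOn := fun v => isCycleOn_univ_permCongr _ (hpc v) }
  have hlab : ∀ t i, gonLabel (h.isDGraph hd) (h.gonEquiv hd i) t = lab t i := fun t i =>
    (mem_gon_iff (h.isDGraph hd) (h.gonEquiv hd i) ⟨t, lab t i⟩).1 rfl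
  refine ⟨⟨⟨C, h.gonEquiv hd r⟩, h.gonEquiv hd⟩, ?_⟩
  refine Prod.ext ((h.gonEquiv hd).symm_apply_apply r) (Prod.ext ?_ ?_)
  · funext t i
    exact hlab t i
  · funext t i
    have h1 := nextGon_eq C ⟨t, lab t i⟩ (F ⟨t, lab t i⟩ ⟨i, rfl⟩)
    change (h.gonEquiv hd).symm (nextGon C t (h.gonEquiv hd i)) = σ t i
    rw [Equiv.symm_apply_eq]
    refine h1.trans ?_
    change ((F ⟨t, lab t i⟩) (p _ ((F ⟨t, lab t i⟩).symm (F ⟨t, lab t i⟩ ⟨i, rfl⟩)))).1 = _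
    rw [Equiv.symm_apply_apply]
    change h.gonEquiv hd (p _ ⟨i, rfl⟩).1 = _
    rw [hp]

end GonGraph

/-! ### Edge-coloured forests -/

section Forest

variable {K I : Type}

/-- A forest on `I` with edges coloured by `K`, given by the map sending a child to the colour of
the edge to its parent and the parent; a vertex has at most one child of every colour. -/
def IsColoredForest (p : I → Option (K × I)) : Prop :=
  (∀ i j x, p i = some x → p j = some x → i = j) ∧
    ∃ rank : I → ℕ, ∀ i t j, p i = some (t, j) → rank j < rank i

/-- The colour of the edge to the parent. -/
def edgeColor (p : I → Option (K × I)) (i : I) : Option K := (p i).map Prod.fst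

theorem edgeColor_eq_some {p : I → Option (K × I)} {i : I} {t : K} :
    edgeColor p i = some t ↔ ∃ j, p i = some (t, j) := by
  simp [edgeColor]

theorem edgeColor_eq_none {p : I → Option (K × I)} {i : I} : edgeColor p i = none ↔ p i = none := by
  simp [edgeColor]

end Forest

/-! ### Correspondence between encoded cacti and labelled trees -/

section LabeledTree

variable {d : ℕ} {nn : Fin d → ℕ} {I : Type}

/-- The forest `p` is a tree with root `r`, and the components of its edges of colour `t` are
labelled bijectively by `lab t`. -/
structure IsLabeledTree (r : I) (p : I → Option (Fin d × I)) (lab : ∀ t : Fin d, I → Fin (nn t)) :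
    Prop where
  isColoredForest : IsColoredForest p
  none_iff : ∀ i, p i = none ↔ i = r
  lab_eq : ∀ i t j, p i = some (t, j) → lab t i = lab t j
  existsUnique_head : ∀ t k, ∃! i, lab t i = k ∧ edgeColor p i ≠ some t

open Classical in
/-- The rotation permuting cyclically every path of colour `t`. -/
noncomputable def rotation (p : I → Option (Fin d × I)) (lab : ∀ t : Fin d, I → Fin (nn t))
    (t : Fin d) (j : I) : I :=
  if h : ∃ i, p i = some (t, j) then h.choose
  -- The last gon of a path goes back to its head; the default `j` never occurs in a labelled tree.
  else if h' : ∃ i, lab t i = lab t j ∧ edgeColor p i ≠ some t then h'.choose else j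

variable {r : I} {p : I → Option (Fin d × I)} {lab : ∀ t : Fin d, I → Fin (nn t)}

theorem IsColoredForest.rotation_eq (h : IsColoredForest p) {t : Fin d} {i j : I}
    (hij : p i = some (t, j)) : rotation p lab t j = i := by
  have hex : ∃ i, p i = some (t, j) := ⟨i, hij⟩
  rw [rotation, dif_pos hex]
  exact h.1 _ _ _ hex.choose_spec hij

theorem IsLabeledTree.rotation_head (h : IsLabeledTree r p lab) {t : Fin d} {j : I}
    (hj : ¬ ∃ i, p i = some (t, j)) :
    lab t (rotation p lab t j) = lab t j ∧ edgeColor p (rotation p lab t j) ≠ some t := by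
  have hex : ∃ i, lab t i = lab t j ∧ edgeColor p i ≠ some t :=
    (h.existsUnique_head t (lab t j)).exists
  rw [rotation, dif_neg hj, dif_pos hex]
  exact hex.choose_spec

theorem IsLabeledTree.lab_rotation (h : IsLabeledTree r p lab) (t : Fin d) (j : I) :
    lab t (rotation p lab t j) = lab t j := by
  by_cases hj : ∃ i, p i = some (t, j)
  · obtain ⟨i, hi⟩ := hj
    rw [h.isColoredForest.rotation_eq hi]
    exact h.lab_eq i t j hi
  · exact (h.rotation_head hj).1

/-- Rotation runs from the head of a path down to each of its gons, and, ranks being bounded, from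
each gon to the end of the path and back to the head. -/
theorem IsLabeledTree.orbits_and_isEntryType [Finite I] (h : IsLabeledTree r p lab) :
    (∀ t i j, lab t i = lab t j ↔ ∃ k, (rotation p lab t)^[k] i = j) ∧
      ∃ rank, IsEntryType r lab (edgeColor p) rank := by
  choose top htop htop' using fun t k => (h.existsUnique_head t k).exists
  have huniq : ∀ t i, edgeColor p i ≠ some t → top t (lab t i) = i := fun t i hi =>
    (h.existsUnique_head t (lab t i)).unique ⟨htop t _, htop' t _⟩ ⟨rfl, hi⟩
  obtain ⟨rank, hrank⟩ := h.isColoredForest.2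
  have hlab : ∀ t k i, lab t ((rotation p lab t)^[k] i) = lab t i := by
    intro t k i
    induction k with
    | zero => rfl
    | succ k ih => rw [Function.iterate_succ_apply', h.lab_rotation, ih]
  have hdown : ∀ t n i, rank i = n → ∃ k, (rotation p lab t)^[k] (top t (lab t i)) = i := by
    intro t n
    induction n using Nat.strong_induction_on with
    | _ n ih =>
      intro i hi
      by_cases hc : edgeColor p i = some t
      · obtain ⟨j, hj⟩ := edgeColor_eq_some.1 hc
        obtain ⟨k, hk⟩ := ih (rank j) (hi ▸ hrank i t j hj) j rfl
        refine ⟨k + 1, ?_⟩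
        rw [h.lab_eq i t j hj, Function.iterate_succ_apply', hk]
        exact h.isColoredForest.rotation_eq hj
      · exact ⟨0, huniq t i hc⟩
  obtain ⟨M, hM⟩ : ∃ M, ∀ i, rank i ≤ M := by
    obtain ⟨M, hM⟩ := (Set.finite_range rank).bddAbove
    exact ⟨M, fun i => hM ⟨i, rfl⟩⟩
  have hup : ∀ t n i, M - rank i = n → ∃ k, (rotation p lab t)^[k] i = top t (lab t i) := by
    intro t n
    induction n using Nat.strong_induction_on with
    | _ n ih =>
      intro i hi
      by_cases hc : ∃ c, p c = some (t, i)
      · obtain ⟨c, hc⟩ := hc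
        have h1 := hrank c t i hc
        have h2 := hM c
        obtain ⟨k, hk⟩ := ih (M - rank c) (by omega) c rfl
        refine ⟨k + 1, ?_⟩
        rw [Function.iterate_succ_apply, h.isColoredForest.rotation_eq hc, hk, h.lab_eq c t i hc]
      · obtain ⟨h1, h2⟩ := h.rotation_head hc
        refine ⟨1, ?_⟩
        rw [Function.iterate_one, ← h1, huniq t _ h2]
  have htlt : ∀ t n i, rank i = n → ∀ j, p i = some (t, j) → rank (top t (lab t i)) < rank i := by
    intro t n
    induction n using Nat.strong_induction_on with
    | _ n ih =>
      intro i hi j hj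
      have h1 := hrank i t j hj
      rw [h.lab_eq i t j hj]
      by_cases hc : edgeColor p j = some t
      · obtain ⟨j', hj'⟩ := edgeColor_eq_some.1 hc
        exact (ih (rank j) (hi ▸ h1) j rfl j' hj').trans h1
      · rwa [huniq t j hc]
  -- The forest rank grows along a path, while `rank_eq` wants a constant; the rank of the head of
  -- the path plus one is used instead.
  let rk : I → ℕ := fun i => match edgeColor p i with
    | none => 0
    | some t => rank (top t (lab t i)) + 1
  have hrk : ∀ i t, edgeColor p i = some t → rk i = rank (top t (lab t i)) + 1 := by
    intro i t hi
    simp only [rk, hi]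
  refine ⟨fun t i j => ⟨fun hij => ?_, ?_⟩, rk, ?_, h.existsUnique_head, ?_, ?_⟩
  · obtain ⟨k, hk⟩ := hup t _ i rfl
    obtain ⟨l, hl⟩ := hdown t _ j rfl
    refine ⟨l + k, ?_⟩
    rw [Function.iterate_add_apply, hk, hij, hl]
  · rintro ⟨k, rfl⟩
    exact (hlab t k i).symm
  · intro i
    rw [edgeColor_eq_none, h.none_iff]
  · intro t i j hij hi hj
    rw [hrk j t hj, ← hij, huniq t i hi, Nat.lt_succ_iff]
    cases hc : edgeColor p i with
    | none => simp only [rk, hc, Nat.zero_le]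
    | some s =>
      rw [hrk i s hc]
      obtain ⟨j', hj'⟩ := edgeColor_eq_some.1 hc
      exact htlt s _ i rfl j' hj'
  · intro t i j hij hi hj
    rw [hrk i t hi, hrk j t hj, hij]

/-- By induction on rank, the head at the entry vertex of `i` is a head for both assignments;
uniqueness of heads then forces `i` to be entered there in both. -/
theorem IsEntryType.unique {τ τ' : I → Option (Fin d)} {rank rank' : I → ℕ}
    (h : IsEntryType r lab τ rank) (h' : IsEntryType r lab τ' rank') : τ = τ' := by
  have key : ∀ n i, rank i = n → τ i = τ' i := by
    intro n
    induction n using Nat.strong_induction_on with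
    | _ n ih =>
      intro i hi
      cases hτ : τ i with
      | none => exact ((h'.none_iff i).2 ((h.none_iff i).1 hτ)).symm
      | some t =>
        by_contra hne
        obtain ⟨j, ⟨hj, hjt⟩, -⟩ := h.existsUnique_head t (lab t i)
        have hlt := h.rank_lt t j i hj hjt hτ
        rw [ih (rank j) (hi ▸ hlt) j rfl] at hjt
        have hji := (h'.existsUnique_head t (lab t i)).unique ⟨hj, hjt⟩ ⟨rfl, Ne.symm hne⟩
        rw [hji] at hlt
        exact lt_irrefl _ hlt
  exact funext fun i => key _ i rfl

theorem IsTreeLike.bijective [Finite I] {σ : Fin d → I → I} (h : IsTreeLike r lab σ) (t : Fin d) :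
    Function.Bijective (σ t) := by
  have hs : Function.Surjective (σ t) := by
    intro i
    obtain ⟨k, hk⟩ := (h.1 t (σ t i) i).1 ((h.1 t i (σ t i)).2 ⟨1, rfl⟩).symm
    refine ⟨(σ t)^[k] i, ?_⟩
    rw [← Function.iterate_succ_apply' (σ t), Function.iterate_succ_apply, hk]
  exact ⟨Finite.injective_iff_surjective.2 hs, hs⟩

theorem IsLabeledTree.isTreeLike [Finite I] (h : IsLabeledTree r p lab) :
    IsTreeLike r lab (rotation p lab) :=
  ⟨h.orbits_and_isEntryType.1, edgeColor p, h.orbits_and_isEntryType.2⟩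

/-- The labels fix the edge colours, and a parent is the preimage under an injective rotation. -/
theorem IsLabeledTree.eq_of_rotation_eq [Finite I] {p' : I → Option (Fin d × I)}
    (h : IsLabeledTree r p lab) (h' : IsLabeledTree r p' lab)
    (hrot : rotation p lab = rotation p' lab) : p = p' := by
  obtain ⟨rank, hr⟩ := h.orbits_and_isEntryType.2
  obtain ⟨rank', hr'⟩ := h'.orbits_and_isEntryType.2
  have hc : edgeColor p = edgeColor p' := hr.unique hr'
  funext i
  cases hi : edgeColor p i with
  | none =>
    have hi' : edgeColor p' i = none := hc ▸ hi
    rw [edgeColor_eq_none.1 hi, edgeColor_eq_none.1 hi']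
  | some t =>
    obtain ⟨j, hj⟩ := edgeColor_eq_some.1 hi
    have hi' : edgeColor p' i = some t := hc ▸ hi
    obtain ⟨j', hj'⟩ := edgeColor_eq_some.1 hi'
    rw [hj, hj']
    have h1 := h.isColoredForest.rotation_eq (lab := lab) hj
    have h2 := h'.isColoredForest.rotation_eq (lab := lab) hj'
    rw [← hrot] at h2
    rw [(h.isTreeLike.bijective t).1 (h1.trans h2.symm)]

/-- Each cycle of `σ t` is cut just before its head: a gon entered through type `t` has its
predecessor under `σ t` as parent. -/
theorem IsTreeLike.exists_rotation_eq [Finite I] {σ : Fin d → I → I} (h : IsTreeLike r lab σ) :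
    ∃ p, IsLabeledTree r p lab ∧ rotation p lab = σ := by
  have hbij := h.bijective
  obtain ⟨hσ, τ, rank, hτ⟩ := h
  choose pred hpred using fun t => (hbij t).2
  choose top htop htop' using fun t k => (hτ.existsUnique_head t k).exists
  have hpred' : ∀ t i, pred t (σ t i) = i := fun t i => (hbij t).1 (hpred t _)
  have hlab : ∀ t i, lab t (pred t i) = lab t i := fun t i =>
    (hσ t _ _).2 ⟨1, hpred t i⟩
  let p : I → Option (Fin d × I) := fun i => (τ i).map fun t => (t, pred t i)
  have hp : ∀ i t j, p i = some (t, j) ↔ τ i = some t ∧ pred t i = j := by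
    intro i t j
    simp only [p, Option.map_eq_some_iff, Prod.mk.injEq]
    constructor
    · rintro ⟨s, hs, rfl, h⟩
      exact ⟨hs, h⟩
    · rintro ⟨hs, h⟩
      exact ⟨t, hs, rfl, h⟩
  have hcol : edgeColor p = τ := by
    funext i
    simp [edgeColor, p, Function.comp_def]
  have hex : ∀ t i, ∃ k, (σ t)^[k] (top t (lab t i)) = i := fun t i => (hσ t _ _).1 (htop t _)
  classical
  let pos : Fin d → I → ℕ := fun t i => Nat.find (hex t i)
  obtain ⟨N, hN⟩ : ∃ N, ∀ t i, pos t i < N := by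
    obtain ⟨M, hM⟩ := (Set.finite_range fun x : Fin d × I => pos x.1 x.2).bddAbove
    exact ⟨M + 1, fun t i => Nat.lt_succ_of_le (hM ⟨(t, i), rfl⟩)⟩
  -- Lexicographic order on the pair (rank, position after the head), `N` exceeding all positions:
  -- the parent either has the same rank and an earlier position, or a smaller rank.
  let rk : I → ℕ := fun i => N * rank i + (τ i).elim 0 fun t => pos t i
  have hrk : ∀ i, rk i < N * (rank i + 1) ∨ τ i = none ∧ rk i = N * rank i := by
    intro i
    cases hi : τ i with
    | none => simp [rk, hi]
    | some t =>
      left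
      have := hN t i
      simp only [rk, hi, Option.elim_some, mul_add, mul_one]
      omega
  have htree : IsLabeledTree r p lab := by
    refine ⟨⟨?_, rk, ?_⟩, ?_, ?_, ?_⟩
    · rintro i j ⟨t, x⟩ hi hj
      rw [hp] at hi hj
      rw [← hpred t i, ← hpred t j, hi.2, hj.2]
    · intro i t j hij
      obtain ⟨hi, rfl⟩ := (hp _ _ _).1 hij
      by_cases hj : τ (pred t i) = some t
      · have h1 := hτ.rank_eq t (pred t i) i (hlab t i) hj hi
        simp only [rk, hi, hj, h1, Option.elim_some]
        have h2 := Nat.find_spec (hex t i)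
        have h3 : Nat.find (hex t i) ≠ 0 := by
          intro h0
          rw [h0] at h2
          exact htop' t (lab t i) (by rw [show top t (lab t i) = i from h2, hi])
        obtain ⟨m, hm⟩ := Nat.exists_eq_succ_of_ne_zero h3
        rw [hm, Function.iterate_succ_apply'] at h2
        have h4 : (σ t)^[m] (top t (lab t (pred t i))) = pred t i := by
          apply (hbij t).1
          rw [hlab, h2, hpred]
        have h5 : pos t (pred t i) ≤ m := Nat.find_min' _ h4
        have h6 : pos t i = m + 1 := hm
        omega
      · have h1 := hτ.rank_lt t (pred t i) i (hlab t i) hj hi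
        have h2 : N * (rank (pred t i) + 1) ≤ N * rank i := Nat.mul_le_mul_left _ h1
        have h3 : N * rank i ≤ rk i := Nat.le_add_right _ _
        have h4 := hN t i
        rcases hrk (pred t i) with h | ⟨-, h⟩
        · omega
        · rw [h]
          rw [mul_add] at h2
          omega
    · intro i
      rw [← edgeColor_eq_none, hcol, hτ.none_iff]
    · intro i t j hij
      obtain ⟨-, rfl⟩ := (hp _ _ _).1 hij
      exact (hlab t i).symm
    · rw [hcol]
      exact hτ.existsUnique_head
  refine ⟨p, htree, ?_⟩
  funext t j
  by_cases hj : ∃ i, p i = some (t, j)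
  · obtain ⟨i, hi⟩ := hj
    rw [htree.isColoredForest.rotation_eq hi]
    obtain ⟨-, rfl⟩ := (hp _ _ _).1 hi
    exact (hpred t i).symm
  · refine (htree.existsUnique_head t (lab t j)).unique (htree.rotation_head hj) ⟨?_, ?_⟩
    · exact ((hσ t _ _).2 ⟨1, rfl⟩).symm
    · rw [hcol]
      intro h
      exact hj ⟨σ t j, (hp _ _ _).2 ⟨h, hpred' t j⟩⟩

/-- Cacti with gons labelled by `I` correspond to labelled trees on `I`. -/
theorem card_sigma_equiv_gon [Finite I] (hd : 2 ≤ d) :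
    Nat.card (Σ C : RootedLabeledCactus nn, I ≃ Gon C.graph) =
      Nat.card {x : I × (I → Option (Fin d × I)) × (∀ t : Fin d, I → Fin (nn t)) //
        IsLabeledTree x.1 x.2.1 x.2.2} := by
  let T : Type := {y : I × (∀ t : Fin d, I → Fin (nn t)) × (Fin d → I → I) //
    IsTreeLike y.1 y.2.1 y.2.2}
  let f : (Σ C : RootedLabeledCactus nn, I ≃ Gon C.graph) → T :=
    fun x => ⟨toDatum x, isTreeLike_toDatum x⟩
  let g : {x : I × (I → Option (Fin d × I)) × (∀ t : Fin d, I → Fin (nn t)) //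
      IsLabeledTree x.1 x.2.1 x.2.2} → T :=
    fun x => ⟨(x.1.1, x.1.2.2, rotation x.1.2.1 x.1.2.2), x.2.isTreeLike⟩
  have hf : Function.Bijective f := by
    refine ⟨fun x y h => toDatum_injective (congrArg Subtype.val h), ?_⟩
    rintro ⟨⟨r, lab, σ⟩, h⟩
    obtain ⟨x, hx⟩ := exists_toDatum_eq hd h
    exact ⟨x, Subtype.ext hx⟩
  have hg : Function.Bijective g := by
    constructor
    · rintro ⟨⟨r, p, lab⟩, h⟩ ⟨⟨r', p', lab'⟩, h'⟩ heq
      have heq' := congrArg Subtype.val heq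
      simp only [g, Prod.mk.injEq] at heq'
      obtain ⟨rfl, rfl, hrot⟩ := heq'
      obtain rfl := h.eq_of_rotation_eq h' hrot
      rfl
    · rintro ⟨⟨r, lab, σ⟩, h⟩
      obtain ⟨p, hp, hrot⟩ := h.exists_rotation_eq
      exact ⟨⟨(r, p, lab), hp⟩, Subtype.ext (by simp only [g, hrot])⟩
  rw [Nat.card_eq_of_bijective f hf, Nat.card_eq_of_bijective g hg]

end LabeledTree

/-! ### Counting coloured forests -/

section ForestCount

variable {K I : Type}

/-- Every vertex of a forest has a closest ancestor in `S`, if `S` contains the roots. -/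
theorem IsColoredForest.exists_top [Finite I] {p : I → Option (K × I)} (h : IsColoredForest p)
    {S : Set I} (hS : ∀ i ∉ S, p i ≠ none) :
    ∃ top : I → I, (∀ i, top i ∈ S) ∧ (∀ i ∈ S, top i = i) ∧
      ∀ i ∉ S, ∀ t j, p i = some (t, j) → top i = top j := by
  classical
  obtain ⟨-, rank, hrank⟩ := h
  obtain ⟨M, hM⟩ : ∃ M, ∀ i, rank i ≤ M := by
    obtain ⟨M, hM⟩ := (Set.finite_range rank).bddAbove
    exact ⟨M, fun i => hM ⟨i, rfl⟩⟩
  let step : I → I := fun i => if i ∈ S then i else (p i).elim i Prod.snd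
  have hstep : ∀ i ∈ S, step i = i := fun i hi => if_pos hi
  have hstep' : ∀ i ∉ S, ∀ t j, p i = some (t, j) → step i = j := by
    intro i hi t j hij
    simp [step, hi, hij]
  have hk : ∀ k i, step^[k] i ∈ S ∨ rank (step^[k] i) + k ≤ rank i := by
    intro k i
    induction k with
    | zero => exact Or.inr le_rfl
    | succ k ih =>
      rw [Function.iterate_succ_apply']
      by_cases hs : step^[k] i ∈ S
      · left
        rwa [hstep _ hs]
      · right
        obtain ⟨⟨t, j⟩, hj⟩ := Option.ne_none_iff_exists'.1 (hS _ hs)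
        rw [hstep' _ hs t j hj]
        have := hrank _ t j hj
        have := ih.resolve_left hs
        omega
  have hmem : ∀ i, step^[M + 1] i ∈ S := by
    intro i
    rcases hk (M + 1) i with h | h
    · exact h
    · have := hM i
      omega
  refine ⟨step^[M + 1], hmem, fun i hi => Function.iterate_fixed (hstep i hi) _, ?_⟩
  intro i hi t j hij
  have h1 := Function.iterate_succ_apply step (M + 1) i
  rw [Function.iterate_succ_apply' step (M + 1), hstep _ (hmem i), hstep' i hi t j hij] at h1
  exact h1

/-- `Ancestor p i j`: the vertex `j` is `i` or an ancestor of `i`. -/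
def Ancestor (p : I → Option (K × I)) (i j : I) : Prop :=
  Relation.ReflTransGen (fun i j => ∃ t, p i = some (t, j)) i j

theorem ancestor_iff_of_eq_some {p : I → Option (K × I)} {i j r : I} {t : K}
    (hij : p i = some (t, j)) (hr : p r = none) : Ancestor p i r ↔ Ancestor p j r := by
  constructor
  · intro h
    rcases Relation.ReflTransGen.cases_head h with rfl | ⟨k, ⟨s, hk⟩, h⟩
    · rw [hij] at hr
      cases hr
    · rw [hij] at hk
      obtain ⟨rfl, rfl⟩ := Prod.mk.inj (Option.some.inj hk)
      exact h
  · exact fun h => Relation.ReflTransGen.head ⟨t, hij⟩ h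

theorem IsColoredForest.existsUnique_root [Finite I] {p : I → Option (K × I)}
    (h : IsColoredForest p) (i : I) : ∃! r, p r = none ∧ Ancestor p i r := by
  obtain ⟨top, h1, h2, h3⟩ := h.exists_top (S := {i | p i = none}) fun _ hi => hi
  have key : ∀ j, Ancestor p i j → top i = top j := by
    intro j hj
    induction hj with
    | refl => rfl
    | tail _ hab ih =>
      obtain ⟨t, ht⟩ := hab
      refine ih.trans (h3 _ ?_ t _ ht)
      change ¬ _ = none
      simp [ht]
  have hex : ∀ n i, h.2.choose i = n → ∃ r, p r = none ∧ Ancestor p i r := by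
    intro n
    induction n using Nat.strong_induction_on with
    | _ n ih =>
      intro i hi
      cases hp : p i with
      | none => exact ⟨i, hp, Relation.ReflTransGen.refl⟩
      | some x =>
        obtain ⟨t, j⟩ := x
        obtain ⟨r, hr, hjr⟩ := ih _ (hi ▸ h.2.choose_spec i t j hp) j rfl
        exact ⟨r, hr, (ancestor_iff_of_eq_some hp hr).2 hjr⟩
  obtain ⟨r, hr⟩ := hex _ i rfl
  refine ⟨r, hr, fun s hs => ?_⟩
  rw [← h2 r hr.1, ← h2 s hs.1, ← key r hr.2, ← key s hs.2]

theorem IsColoredForest.update_some [DecidableEq I] {p : I → Option (K × I)}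
    (h : IsColoredForest p) {t : K} {j r : I} (hj : ∀ i, p i ≠ some (t, j)) (hr : p r = none)
    (hjr : ¬ Ancestor p j r) : IsColoredForest (Function.update p r (some (t, j))) := by
  classical
  obtain ⟨hinj, rank, hrank⟩ := h
  -- The tree of `r` is hung below `j`: its ranks are raised above that of `j`, which lies in
  -- another tree and keeps its rank.
  refine ⟨?_, fun i => rank i + if Ancestor p i r then rank j + 1 else 0, ?_⟩
  · intro a b x ha hb
    by_cases har : a = r <;> by_cases hbr : b = r
    · rw [har, hbr]
    · rw [Function.update_of_ne hbr] at hb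
      rw [har, Function.update_self] at ha
      exact absurd (hb.trans ha.symm) (hj b)
    · rw [Function.update_of_ne har] at ha
      rw [hbr, Function.update_self] at hb
      exact absurd (ha.trans hb.symm) (hj a)
    · rw [Function.update_of_ne har] at ha
      rw [Function.update_of_ne hbr] at hb
      exact hinj a b x ha hb
  · intro a s b hab
    by_cases har : a = r
    · rw [har, Function.update_self] at hab
      obtain ⟨rfl, rfl⟩ := Prod.mk.inj (Option.some.inj hab)
      have hrr : Ancestor p r r := Relation.ReflTransGen.refl
      simp only [har, if_pos hrr, if_neg hjr]
      omega
    · rw [Function.update_of_ne har] at hab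
      have := hrank a s b hab
      simp only [ancestor_iff_of_eq_some hab hr]
      omega

theorem IsColoredForest.update_none [DecidableEq I] {p : I → Option (K × I)}
    (h : IsColoredForest p) {t : K} {i j : I} (hij : p i = some (t, j)) :
    IsColoredForest (Function.update p i none) ∧ (∀ k, Function.update p i none k ≠ some (t, j)) ∧
      ¬ Ancestor (Function.update p i none) j i := by
  obtain ⟨hinj, rank, hrank⟩ := h
  have hle : ∀ a x, Function.update p i none a = some x → a ≠ i ∧ p a = some x := by
    intro a x ha
    by_cases hai : a = i
    · rw [hai, Function.update_self] at ha
      cases ha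
    · rw [Function.update_of_ne hai] at ha
      exact ⟨hai, ha⟩
  refine ⟨⟨fun a b x ha hb => hinj a b x (hle a x ha).2 (hle b x hb).2, rank,
    fun a s b hab => hrank a s b (hle a _ hab).2⟩, fun k hk => ?_, fun hji => ?_⟩
  · exact (hle k _ hk).1 (hinj k i _ (hle k _ hk).2 hij)
  · have hmono : ∀ b, Ancestor (Function.update p i none) j b → rank b ≤ rank j := by
      intro b hb
      induction hb with
      | refl => exact le_rfl
      | tail _ hab ih =>
        obtain ⟨s, hs⟩ := hab
        exact (hrank _ s _ (hle _ _ hs).2).le.trans ih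
    have := hmono i hji
    have := hrank i t j hij
    omega

variable [Fintype I] [DecidableEq K]

/-- The number of edges of a given colour. -/
def colorCount (p : I → Option (K × I)) (t : K) : ℕ :=
  (Finset.univ.filter fun i => edgeColor p i = some t).card

theorem card_heads (p : I → Option (K × I)) (t : K) :
    (Finset.univ.filter fun i => edgeColor p i ≠ some t).card = Fintype.card I - colorCount p t := by
  have := Finset.card_filter_add_card_filter_not (s := (Finset.univ : Finset I))
    (fun i => edgeColor p i = some t)
  rw [Finset.card_univ] at this
  rw [colorCount]
  simp only [ne_eq]
  omega

/-- Sending a child to its parent is injective on the edges of colour `t`. -/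
theorem IsColoredForest.card_no_child [DecidableEq I] {p : I → Option (K × I)} (h : IsColoredForest p) (t : K) :
    (Finset.univ.filter fun j => ∀ i, p i ≠ some (t, j)).card =
      Fintype.card I - colorCount p t := by
  have h1 := Finset.card_filter_add_card_filter_not (s := (Finset.univ : Finset I))
    (fun j => ∀ i, p i ≠ some (t, j))
  have h2 : (Finset.univ.filter fun j => ¬ ∀ i, p i ≠ some (t, j)).card = colorCount p t := by
    symm
    refine Finset.card_bij (fun i _ => ((p i).map Prod.snd).getD i) ?_ ?_ ?_
    · intro i hi
      obtain ⟨j, hj⟩ := edgeColor_eq_some.1 (Finset.mem_filter.1 hi).2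
      simp only [Finset.mem_filter, Finset.mem_univ, true_and, not_forall, not_not]
      exact ⟨i, by simp [hj]⟩
    · intro i hi i' hi' heq
      obtain ⟨j, hj⟩ := edgeColor_eq_some.1 (Finset.mem_filter.1 hi).2
      obtain ⟨j', hj'⟩ := edgeColor_eq_some.1 (Finset.mem_filter.1 hi').2
      simp only [hj, hj', Option.map_some, Option.getD_some] at heq
      subst heq
      exact h.1 _ _ _ hj hj'
    · intro j hj
      simp only [Finset.mem_filter, Finset.mem_univ, true_and, not_forall, not_not] at hj
      obtain ⟨i, hi⟩ := hj
      exact ⟨i, Finset.mem_filter.2 ⟨Finset.mem_univ _, edgeColor_eq_some.2 ⟨j, hi⟩⟩, by simp [hi]⟩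
  rw [Finset.card_univ] at h1
  omega

theorem colorCount_update_some [DecidableEq I] {p : I → Option (K × I)} {r : I} (hr : p r = none) (t : K) (j : I)
    (s : K) : colorCount (Function.update p r (some (t, j))) s =
      Function.update (colorCount p) t (colorCount p t + 1) s := by
  by_cases hst : s = t
  · subst hst
    rw [Function.update_self, colorCount, colorCount, ← Finset.card_insert_of_notMem (a := r)]
    · congr 1
      ext i
      by_cases hi : i = r
      · simp [hi, edgeColor]
      · simp [hi, edgeColor]
    · simp [edgeColor, hr]
  · rw [Function.update_of_ne hst, colorCount, colorCount]
    congr 1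
    ext i
    by_cases hi : i = r
    · subst hi
      simp [edgeColor, hr, Ne.symm hst]
    · simp [hi, edgeColor]

variable [Fintype K]

theorem card_roots_add_sum_colorCount (p : I → Option (K × I)) :
    (Finset.univ.filter fun i => p i = none).card + ∑ t, colorCount p t = Fintype.card I := by
  have h := Finset.card_eq_sum_card_fiberwise (s := (Finset.univ : Finset I))
    (t := (Finset.univ : Finset (Option K))) (f := edgeColor p) (by simp [Set.MapsTo])
  rw [Fintype.sum_option, Finset.card_univ] at h
  simp only [edgeColor_eq_none] at h
  exact h.symm

open Classical in
-- Each edge lowers the number of roots by one, and exactly one root lies above `j`.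
theorem IsColoredForest.card_other_roots {p : I → Option (K × I)} (h : IsColoredForest p) (j : I) :
    (Finset.univ.filter fun r => p r = none ∧ ¬ Ancestor p j r).card =
      Fintype.card I - 1 - ∑ t, colorCount p t := by
  obtain ⟨s, hs, hu⟩ := h.existsUnique_root j
  have h1 := card_roots_add_sum_colorCount p
  have h2 : (Finset.univ.filter fun r => p r = none ∧ ¬ Ancestor p j r) =
      (Finset.univ.filter fun i => p i = none).erase s := by
    ext r
    simp only [Finset.mem_filter, Finset.mem_univ, true_and, Finset.mem_erase]
    constructor
    · rintro ⟨h, h'⟩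
      exact ⟨fun hrs => h' (hrs ▸ hs.2), h⟩
    · rintro ⟨h, h'⟩
      exact ⟨h', fun hjr => h (hu r ⟨h', hjr⟩)⟩
  rw [h2, Finset.card_erase_of_mem (by simpa using hs.1)]
  omega

variable [DecidableEq I]

open Classical in
/-- The forests on `I` with a given number of edges of every colour. -/
noncomputable def coloredForests (I : Type) [Fintype I] [DecidableEq I] (m : K → ℕ) :
    Finset (I → Option (K × I)) :=
  Finset.univ.filter fun p => IsColoredForest p ∧ ∀ t, colorCount p t = m t

theorem mem_coloredForests {m : K → ℕ} {p : I → Option (K × I)} :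
    p ∈ coloredForests I m ↔ IsColoredForest p ∧ ∀ t, colorCount p t = m t := by
  simp [coloredForests]

open Classical in
-- Double counting: a forest with a marked edge of colour `t` corresponds, by deleting that edge, to
-- a smaller forest with a vertex `j` lacking a child of colour `t` and the root `r` of another
-- tree.
theorem card_coloredForests_succ (m : K → ℕ) (t : K) :
    (coloredForests I (Function.update m t (m t + 1))).card * (m t + 1) =
      (coloredForests I m).card * ((Fintype.card I - m t) * (Fintype.card I - 1 - ∑ s, m s)) := by
  have h1 : ((coloredForests I (Function.update m t (m t + 1))).sigma fun p =>
      Finset.univ.filter fun i => edgeColor p i = some t).card =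
      (coloredForests I (Function.update m t (m t + 1))).card * (m t + 1) := by
    rw [Finset.card_sigma, Finset.sum_const_nat]
    intro p hp
    have := (mem_coloredForests.1 hp).2 t
    rwa [Function.update_self] at this
  have h2 : ((coloredForests I m).sigma fun p =>
      (Finset.univ.filter fun j => ∀ i, p i ≠ some (t, j)).sigma fun j =>
        Finset.univ.filter fun r => p r = none ∧ ¬ Ancestor p j r).card =
      (coloredForests I m).card * ((Fintype.card I - m t) * (Fintype.card I - 1 - ∑ s, m s)) := by
    rw [Finset.card_sigma, Finset.sum_const_nat]
    intro p hp
    obtain ⟨hp, hm⟩ := mem_coloredForests.1 hp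
    rw [Finset.card_sigma, Finset.sum_const_nat (m := Fintype.card I - 1 - ∑ s, m s),
      hp.card_no_child, hm]
    intro j _
    rw [hp.card_other_roots]
    simp only [hm]
  rw [← h1, ← h2]
  symm
  refine Finset.card_bij
    (fun x _ => ⟨Function.update x.1 x.2.2 (some (t, x.2.1)), x.2.2⟩) ?_ ?_ ?_
  · rintro ⟨p, j, r⟩ hx
    simp only [Finset.mem_sigma, mem_coloredForests, Finset.mem_filter, Finset.mem_univ,
      true_and] at hx ⊢
    obtain ⟨⟨hp, hm⟩, hj, hr, hjr⟩ := hx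
    refine ⟨⟨hp.update_some hj hr hjr, fun s => ?_⟩, by simp [edgeColor]⟩
    rw [colorCount_update_some hr, funext hm]
  · rintro ⟨p, j, r⟩ hx ⟨p', j', r'⟩ hx' heq
    simp only [Finset.mem_sigma, mem_coloredForests, Finset.mem_filter, Finset.mem_univ,
      true_and] at hx hx'
    simp only [Sigma.mk.injEq, heq_eq_eq] at heq
    obtain ⟨h1, rfl⟩ := heq
    have h3 := congrFun h1 r
    rw [Function.update_self, Function.update_self] at h3
    obtain ⟨-, rfl⟩ := Prod.mk.inj (Option.some.inj h3)
    have h4 : p = p' := by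
      funext i
      by_cases hi : i = r
      · rw [hi, hx.2.2.1, hx'.2.2.1]
      · have := congrFun h1 i
        rwa [Function.update_of_ne hi, Function.update_of_ne hi] at this
    subst h4
    rfl
  · rintro ⟨p, i⟩ hx
    simp only [Finset.mem_sigma, mem_coloredForests, Finset.mem_filter, Finset.mem_univ,
      true_and] at hx
    obtain ⟨⟨hp, hm⟩, hi⟩ := hx
    obtain ⟨j, hj⟩ := edgeColor_eq_some.1 hi
    obtain ⟨h3, h4, h5⟩ := hp.update_none hj
    have h6 : Function.update (Function.update p i none) i (some (t, j)) = p := by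
      rw [Function.update_idem, ← hj, Function.update_eq_self]
    have h7 : ∀ s, colorCount (Function.update p i none) s = m s := by
      intro s
      have h8 := colorCount_update_some (p := Function.update p i none) (r := i)
        (Function.update_self _ _ _) t j
      rw [h6] at h8
      have h9 := h8 s
      rw [hm] at h9
      by_cases hst : s = t
      · subst hst
        rw [Function.update_self, Function.update_self] at h9
        omega
      · rwa [Function.update_of_ne hst, Function.update_of_ne hst, eq_comm] at h9
    refine ⟨⟨Function.update p i none, j, i⟩, ?_, ?_⟩
    · simp only [Finset.mem_sigma, mem_coloredForests, Finset.mem_filter, Finset.mem_univ,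
        true_and]
      exact ⟨⟨h3, h7⟩, h4, Function.update_self _ _ _, h5⟩
    · simp only [h6]

theorem card_coloredForests_zero : (coloredForests I (0 : K → ℕ)).card = 1 := by
  rw [Finset.card_eq_one]
  refine ⟨fun _ => none, ?_⟩
  ext p
  rw [mem_coloredForests, Finset.mem_singleton]
  constructor
  · rintro ⟨-, h⟩
    funext i
    rw [← edgeColor_eq_none]
    cases hi : edgeColor p i with
    | none => rfl
    | some t =>
      have h0 := h t
      simp only [colorCount, Pi.zero_apply, Finset.card_eq_zero] at h0
      exact absurd (Finset.mem_filter.2 ⟨Finset.mem_univ i, hi⟩) (h0 ▸ Finset.notMem_empty i)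
  · rintro rfl
    exact ⟨⟨fun _ _ _ h => by simp at h, fun _ => 0, fun _ _ _ h => by simp at h⟩,
      fun t => by simp [colorCount, edgeColor]⟩

/-- The number of forests with given numbers of edges of every colour. -/
theorem card_coloredForests (m : K → ℕ) :
    (coloredForests I m).card * ∏ t, (m t)! =
      (∏ t, (Fintype.card I).descFactorial (m t)) *
        (Fintype.card I - 1).descFactorial (∑ t, m t) := by
  induction hN : ∑ t, m t generalizing m with
  | zero =>
    obtain rfl : m = 0 := by
      funext t
      exact (Finset.sum_eq_zero_iff.1 hN) t (Finset.mem_univ t)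
    simp [card_coloredForests_zero]
  | succ N ih =>
    obtain ⟨t, -, ht⟩ : ∃ t ∈ Finset.univ, m t ≠ 0 := by
      by_contra! h
      rw [Finset.sum_eq_zero h] at hN
      omega
    obtain ⟨k, hk⟩ := Nat.exists_eq_succ_of_ne_zero ht
    obtain ⟨m', rfl, hm'⟩ : ∃ m', Function.update m' t (m' t + 1) = m ∧ m' t = k := by
      refine ⟨Function.update m t k, ?_, by simp⟩
      simp [← Nat.succ_eq_add_one, ← hk]
    have hsum : ∑ s, m' s = N := by
      rw [Finset.sum_update_of_mem (Finset.mem_univ t)] at hN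
      have := Finset.add_sum_erase Finset.univ m' (Finset.mem_univ t)
      rw [Finset.sdiff_singleton_eq_erase] at hN
      omega
    have hprod : ∀ f : ℕ → ℕ, ∏ s, f (Function.update m' t (m' t + 1) s) =
        f (m' t + 1) * ∏ s ∈ Finset.univ.erase t, f (m' s) := by
      intro f
      rw [← Finset.mul_prod_erase _ _ (Finset.mem_univ t), Function.update_self]
      congr 1
      refine Finset.prod_congr rfl fun s hs => ?_
      rw [Function.update_of_ne (Finset.ne_of_mem_erase hs)]
    have hprod' : ∀ f : ℕ → ℕ, ∏ s, f (m' s) =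
        f (m' t) * ∏ s ∈ Finset.univ.erase t, f (m' s) := fun f =>
      (Finset.mul_prod_erase _ _ (Finset.mem_univ t)).symm
    have h1 := ih m' hsum
    have h2 := card_coloredForests_succ (I := I) m' t
    rw [hprod' fun x => x !, hprod' (Fintype.card I).descFactorial] at h1
    rw [hprod fun x => x !, hprod (Fintype.card I).descFactorial, Nat.factorial_succ,
      Nat.descFactorial_succ, Nat.descFactorial_succ]
    rw [hsum] at h2
    calc _ = (coloredForests I (Function.update m' t (m' t + 1))).card * (m' t + 1) *
          ((m' t)! * ∏ s ∈ Finset.univ.erase t, (m' s)!) := by ring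
      _ = (Fintype.card I - m' t) * (Fintype.card I - 1 - N) *
          ((coloredForests I m').card * ((m' t)! * ∏ s ∈ Finset.univ.erase t, (m' s)!)) := by
        rw [h2]; ring
      _ = _ := by rw [h1]; ring

end ForestCount

theorem card_equiv_fin {α : Type} [Finite α] (n : ℕ) :
    Nat.card (α ≃ Fin n) = if Nat.card α = n then n ! else 0 := by
  classical
  have := Fintype.ofFinite α
  split_ifs with h
  · have e : α ≃ Fin n := Finite.equivFinOfCardEq h
    rw [Nat.card_eq_fintype_card, Fintype.card_equiv e, ← Nat.card_eq_fintype_card, h]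
  · have : IsEmpty (α ≃ Fin n) := ⟨fun e => h (by rw [Nat.card_congr e, Nat.card_fin])⟩
    exact Nat.card_of_isEmpty

/-! ### Counting trees with labelled components -/

section TreeCount

variable {K I : Type}

/-- The labellings by `Fin k` of the components of the edges of colour `t`. -/
abbrev ComponentLabeling (p : I → Option (K × I)) (t : K) (k : ℕ) : Type :=
  {f : I → Fin k // (∀ i j, p i = some (t, j) → f i = f j) ∧
    ∀ c, ∃! i, f i = c ∧ edgeColor p i ≠ some t}

/-- Each component has one head, a vertex whose parent edge is not of colour `t`, so a labelling
amounts to a bijection from the heads to `Fin k`. -/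
theorem IsColoredForest.card_componentLabeling [Fintype I] [DecidableEq K]
    {p : I → Option (K × I)} (h : IsColoredForest p) (t : K) (k : ℕ) :
    Nat.card (ComponentLabeling p t k) =
      if Fintype.card I - colorCount p t = k then k ! else 0 := by
  obtain ⟨top, h1, h2, h3⟩ := h.exists_top (S := {i | edgeColor p i ≠ some t}) (by
    intro i hi h
    exact hi fun h' => by simp [edgeColor, h] at h')
  have h3' : ∀ i j, p i = some (t, j) → top i = top j := fun i j hij =>
    h3 i (fun hi => hi (edgeColor_eq_some.2 ⟨j, hij⟩)) t j hij
  have hcard : Nat.card {i // edgeColor p i ≠ some t} = Fintype.card I - colorCount p t := by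
    rw [← card_heads, Nat.subtype_card]
    simp
  rw [← hcard, ← card_equiv_fin]
  symm
  refine Nat.card_eq_of_bijective (fun ℓ => ⟨fun i => ℓ ⟨top i, h1 i⟩, fun i j hij => ?_,
    fun c => ⟨(ℓ.symm c).1, ⟨?_, (ℓ.symm c).2⟩, ?_⟩⟩) ⟨?_, ?_⟩
  · simp only [h3' i j hij]
  · simp only [h2 _ (ℓ.symm c).2, Subtype.coe_eta, Equiv.apply_symm_apply]
  · rintro i ⟨hi, hit⟩
    rw [← hi, Equiv.symm_apply_apply]
    exact (h2 i hit).symm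
  · intro ℓ ℓ' heq
    ext1 ⟨i, hi⟩
    have := congrFun (congrArg Subtype.val heq) i
    simpa only [h2 i hi] using this
  · rintro ⟨f, hf, hfu⟩
    have hftop : ∀ i, f (top i) = f i := by
      have key : ∀ n i, h.2.choose i = n → f (top i) = f i := by
        intro n
        induction n using Nat.strong_induction_on with
        | _ n ih =>
          intro i hi
          by_cases hc : edgeColor p i = some t
          · obtain ⟨j, hj⟩ := edgeColor_eq_some.1 hc
            rw [h3' i j hj, hf i j hj]
            exact ih _ (hi ▸ h.2.choose_spec i t j hj) j rfl
          · rw [h2 i hc]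
      exact fun i => key _ i rfl
    refine ⟨Equiv.ofBijective (fun i => f i.1) ⟨?_, ?_⟩, ?_⟩
    · intro a b hab
      exact Subtype.ext ((hfu (f a.1)).unique ⟨rfl, a.2⟩ ⟨hab.symm, b.2⟩)
    · intro c
      obtain ⟨i, hi, -⟩ := hfu c
      exact ⟨⟨i, hi.2⟩, hi.1⟩
    · exact Subtype.ext (funext hftop)

/-- A forest has a single root exactly when it has one edge fewer than vertices; the labellings of
the different colours are independent. -/
theorem card_labeledTrees {d : ℕ} {nn : Fin d → ℕ} [Fintype I] [DecidableEq I] :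
    Nat.card {x : I × (I → Option (Fin d × I)) × (∀ t : Fin d, I → Fin (nn t)) //
        IsLabeledTree x.1 x.2.1 x.2.2} =
      if (∀ t, nn t ≤ Fintype.card I) ∧ ∑ t, (Fintype.card I - nn t) + 1 = Fintype.card I then
        (coloredForests I fun t => Fintype.card I - nn t).card * ∏ t, (nn t)! else 0 := by
  classical
  let P : Type := {p : I → Option (Fin d × I) // IsColoredForest p ∧ ∃! r, p r = none}
  let g : (Σ p : P, ∀ t, ComponentLabeling p.1 t (nn t)) →
      {x : I × (I → Option (Fin d × I)) × (∀ t : Fin d, I → Fin (nn t)) //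
        IsLabeledTree x.1 x.2.1 x.2.2} := fun y =>
    ⟨(y.1.2.2.choose, y.1.1, fun t => (y.2 t).1), y.1.2.1,
      fun i => ⟨fun hi => y.1.2.2.choose_spec.2 i hi,
        fun hi => by rw [hi]; exact y.1.2.2.choose_spec.1⟩,
      fun i t j hij => (y.2 t).2.1 i j hij, fun t => (y.2 t).2.2⟩
  have hg : Function.Bijective g := by
    constructor
    · rintro ⟨⟨p, hp⟩, f⟩ ⟨⟨p', hp'⟩, f'⟩ heq
      have heq' := congrArg Subtype.val heq
      simp only [g, Prod.mk.injEq] at heq'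
      obtain ⟨-, rfl, hf⟩ := heq'
      have : f = f' := funext fun t => Subtype.ext (congrFun hf t)
      rw [this]
    · rintro ⟨⟨r, p, lab⟩, h⟩
      have hr : ∃! r, p r = none := ⟨r, (h.none_iff r).2 rfl, fun s hs => (h.none_iff s).1 hs⟩
      refine ⟨⟨⟨p, h.isColoredForest, hr⟩, fun t => ⟨lab t, fun i j hij => h.lab_eq i t j hij,
        h.existsUnique_head t⟩⟩, Subtype.ext (Prod.ext ?_ rfl)⟩
      exact (h.none_iff _).1 hr.choose_spec.1
  have hle : ∀ (p : I → Option (Fin d × I)) t, colorCount p t ≤ Fintype.card I := fun p t =>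
    Finset.card_le_univ _
  have hroot : ∀ p : I → Option (Fin d × I), (∃! r, p r = none) ↔
      ∑ t, colorCount p t + 1 = Fintype.card I := by
    intro p
    have h1 := card_roots_add_sum_colorCount p
    have h2 : (∃! r, p r = none) ↔ (Finset.univ.filter fun i => p i = none).card = 1 := by
      rw [Finset.card_eq_one, ExistsUnique]
      simp only [Finset.eq_singleton_iff_unique_mem, Finset.mem_filter, Finset.mem_univ, true_and]
    rw [h2]
    omega
  rw [← Nat.card_eq_of_bijective g hg, Nat.card_sigma]
  simp only [Nat.card_pi]
  have hterm : ∀ p : P, ∏ t, Nat.card (ComponentLabeling p.1 t (nn t)) =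
      if ∀ t, Fintype.card I - colorCount p.1 t = nn t then ∏ t, (nn t)! else 0 := by
    intro p
    simp only [p.2.1.card_componentLabeling]
    rw [Finset.prod_ite_zero]
    simp
  rw [Finset.sum_congr rfl fun p _ => hterm p, ← Finset.sum_filter, Finset.sum_const, smul_eq_mul]
  split_ifs with hc
  · congr 1
    refine Finset.card_bij (fun p _ => p.1) ?_ (fun p _ q _ h => Subtype.ext h) ?_
    · intro p hp
      have h1 := (Finset.mem_filter.1 hp).2
      refine mem_coloredForests.2 ⟨p.2.1, fun t => ?_⟩
      have := h1 t
      have := hle p.1 t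
      omega
    · intro p hp
      obtain ⟨h1, h2⟩ := mem_coloredForests.1 hp
      refine ⟨⟨p, h1, (hroot p).2 ?_⟩, Finset.mem_filter.2 ⟨Finset.mem_univ _, fun t => ?_⟩, rfl⟩
      · rw [Finset.sum_congr rfl fun t _ => h2 t]
        exact hc.2
      · have := hc.1 t
        have := h2 t
        simp only
        omega
  · rw [Finset.filter_false_of_mem, Finset.card_empty, zero_mul]
    intro p _ h
    refine hc ⟨fun t => h t ▸ Nat.sub_le _ _, ?_⟩
    rw [← (hroot p.1).1 p.2.2]
    congr 1
    refine Finset.sum_congr rfl fun t _ => ?_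
    rw [(hroot p.1).1 p.2.2, ← h t]
    have := hle p.1 t
    omega

end TreeCount

/-! ### Counting cacti and the final arithmetic -/

section CactusCount

variable {d : ℕ} {nn : Fin d → ℕ}

instance instFiniteRootedLabeledCactus : Finite (RootedLabeledCactus nn) := by
  let f : RootedLabeledCactus nn → Σ G : SimpleGraph (Vertex nn),
      (∀ v, Equiv.Perm (GonAt G v)) × Gon G := fun C => ⟨C.graph, C.next, C.root⟩
  refine Finite.of_injective f ?_
  rintro ⟨⟨G, hG, next, hn⟩, root⟩ ⟨⟨G', hG', next', hn'⟩, root'⟩ h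
  simp only [f, Sigma.mk.injEq] at h
  obtain ⟨rfl, h⟩ := h
  obtain ⟨rfl, rfl⟩ := Prod.mk.inj (eq_of_heq h)
  rfl

theorem card_size_mul_factorial (hd : 2 ≤ d) (n : ℕ) :
    Nat.card {C : RootedLabeledCactus nn // C.size = n} * n ! =
      if (∀ t, nn t ≤ n) ∧ ∑ t, (n - nn t) + 1 = n then
        (coloredForests (Fin n) fun t => n - nn t).card * ∏ t, (nn t)! else 0 := by
  classical
  have := Fintype.ofFinite (RootedLabeledCactus nn)
  have h1 := card_sigma_equiv_gon (nn := nn) (I := Fin n) hd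
  rw [card_labeledTrees, Nat.card_sigma, Fintype.card_fin] at h1
  rw [← h1]
  have h2 : ∀ C : RootedLabeledCactus nn, Nat.card (Fin n ≃ Gon C.graph) =
      if C.size = n then n ! else 0 := fun C => by
    rw [Nat.card_congr (Equiv.symmEquiv (Fin n) (Gon C.graph)), card_equiv_fin]
    rfl
  rw [Finset.sum_congr rfl fun C _ => h2 C, ← Finset.sum_filter, Finset.sum_const, smul_eq_mul,
    Nat.subtype_card]
  simp

theorem card_size_eq_zero (hd : 2 ≤ d) {n : ℕ}
    (h : ¬ ((∀ t, nn t ≤ n) ∧ ∑ t, (n - nn t) + 1 = n)) :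
    Nat.card {C : RootedLabeledCactus nn // C.size = n} = 0 := by
  have := card_size_mul_factorial (nn := nn) hd n
  rw [if_neg h] at this
  exact (Nat.mul_eq_zero.1 this).resolve_right n.factorial_ne_zero

theorem card_size_eq (hd : 2 ≤ d) (hnn : ∀ t, 0 < nn t) {n : ℕ} (hle : ∀ t, nn t ≤ n)
    (hsum : ∑ t, (n - nn t) + 1 = n) :
    Nat.card {C : RootedLabeledCactus nn // C.size = n} =
      n ^ (d - 1) * ∏ t, ((n - 1).choose (nn t - 1) * (nn t - 1)!) := by
  have h1 := card_size_mul_factorial (nn := nn) hd n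
  rw [if_pos ⟨hle, hsum⟩] at h1
  have h2 := card_coloredForests (I := Fin n) (fun t => n - nn t)
  rw [Fintype.card_fin, show ∑ t, (n - nn t) = n - 1 by omega, Nat.descFactorial_self] at h2
  have h3 : (∏ t, (nn t)!) * ∏ t, n.descFactorial (n - nn t) = n ! ^ d := by
    rw [← Finset.prod_mul_distrib, Finset.prod_congr rfl fun t _ => show _ = n ! from ?_]
    · simp
    · have := Nat.factorial_mul_descFactorial (Nat.sub_le n (nn t))
      rwa [Nat.sub_sub_self (hle t)] at this
  have h4 : (∏ t, ((n - 1).choose (nn t - 1) * (nn t - 1)!)) * ∏ t, (n - nn t)! = (n - 1)! ^ d := by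
    rw [← Finset.prod_mul_distrib, Finset.prod_congr rfl fun t _ => show _ = (n - 1)! from ?_]
    · simp
    · have := Nat.choose_mul_factorial_mul_factorial (Nat.sub_le_sub_right (hle t) 1)
      rwa [show n - 1 - (nn t - 1) = n - nn t by have := hnn t; have := hle t; omega] at this
  have h5 : n * (n - 1)! = n ! := Nat.mul_factorial_pred (by omega)
  have h6 : n * n ^ (d - 1) = n ^ d := by
    rw [← pow_succ', Nat.sub_add_cancel (by omega)]
  -- Both sides are multiplied by this number to keep the computation free of division.
  have hpos : 0 < n ! * ∏ t, (n - nn t)! :=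
    Nat.mul_pos n.factorial_pos (Finset.prod_pos fun t _ => Nat.factorial_pos _)
  refine Nat.eq_of_mul_eq_mul_right hpos ?_
  calc _ = (Nat.card {C : RootedLabeledCactus nn // C.size = n} * n !) * ∏ t, (n - nn t)! := by
        ring
    _ = ((coloredForests (Fin n) fun t => n - nn t).card * ∏ t, (n - nn t)!) *
        ∏ t, (nn t)! := by rw [h1]; ring
    _ = ((∏ t, (nn t)!) * ∏ t, n.descFactorial (n - nn t)) * (n - 1)! := by rw [h2]; ring
    _ = (n * n ^ (d - 1)) * (n - 1)! ^ d * (n - 1)! := by rw [h3, h6, ← h5, mul_pow]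
    _ = n ^ (d - 1) * ((∏ t, ((n - 1).choose (nn t - 1) * (nn t - 1)!)) *
        ∏ t, (n - nn t)!) * n ! := by rw [h4, ← h5]; ring
    _ = _ := by ring

theorem div_eq_iff_sum_add_one_eq (hd : 2 ≤ d) {n : ℕ} (hle : ∀ t, nn t ≤ n) :
    ((∑ t : Fin d, (nn t : ℚ)) - 1) / ((d : ℚ) - 1) = (n : ℚ) ↔ ∑ t, (n - nn t) + 1 = n := by
  have hd' : (d : ℚ) - 1 ≠ 0 := by
    have : (2 : ℚ) ≤ d := by exact_mod_cast hd
    linarith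
  have hs : ((∑ t, (n - nn t) : ℕ) : ℚ) = d * n - ∑ t, (nn t : ℚ) := by
    rw [Nat.cast_sum, Finset.sum_congr rfl fun t _ => Nat.cast_sub (hle t)]
    simp [Finset.sum_sub_distrib]
  rw [div_eq_iff hd', ← @Nat.cast_inj ℚ, Nat.cast_add, hs, Nat.cast_one]
  constructor <;> intro h <;> linarith

theorem card_size (hd : 2 ≤ d) (hnn : ∀ t, 0 < nn t) (n : ℕ) :
    Nat.card {C : RootedLabeledCactus nn // C.size = n} =
      if ((∑ t : Fin d, (nn t : ℚ)) - 1) / ((d : ℚ) - 1) = (n : ℚ) then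
        n ^ (d - 1) * ∏ t : Fin d, ((n - 1).choose (nn t - 1) * (nn t - 1)!)
      else 0 := by
  by_cases hle : ∀ t, nn t ≤ n
  · split_ifs with h
    · exact card_size_eq hd hnn hle ((div_eq_iff_sum_add_one_eq hd hle).1 h)
    · exact card_size_eq_zero hd fun h' => h ((div_eq_iff_sum_add_one_eq hd hle).2 h'.2)
  · rw [card_size_eq_zero hd fun h => hle h.1]
    split_ifs with h
    · push Not at hle
      obtain ⟨t, ht⟩ := hle
      -- Needed because of the truncated `n - 1`: with `n = 0` the binomial coefficient could fail
      -- to vanish. That case would force `∑ nn t = 1`, below the `d` forced by positivity.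
      have hn : n ≠ 0 := by
        rintro rfl
        have hd' : (d : ℚ) - 1 ≠ 0 := by
          have : (2 : ℚ) ≤ d := by exact_mod_cast hd
          linarith
        rw [div_eq_iff hd', Nat.cast_zero, zero_mul, sub_eq_zero] at h
        have h1 : ∑ t, nn t = 1 := by exact_mod_cast h
        have h2 : ∑ _t : Fin d, 1 ≤ ∑ t, nn t := Finset.sum_le_sum fun t _ => hnn t
        simp at h2
        omega
      rw [Finset.prod_eq_zero (Finset.mem_univ t), mul_zero]
      rw [Nat.choose_eq_zero_of_lt (by omega), zero_mul]
    · rfl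

end CactusCount

end Cactus

theorem mainTheorem12 (d : ℕ) (hd : 2 ≤ d) (nn : Fin d → ℕ) (hnn : ∀ t, 0 < nn t) :
    Finite (RootedLabeledCactus nn) ∧
    (∀ n : ℕ, Nat.card {C : RootedLabeledCactus nn // C.size = n} =
      if ((∑ t : Fin d, (nn t : ℚ)) - 1) / ((d : ℚ) - 1) = (n : ℚ) then
        n ^ (d - 1) * ∏ t : Fin d, ((n - 1).choose (nn t - 1) * (nn t - 1)!)
      else 0) ∧
    (∀ n : ℕ, ((∑ t : Fin d, (nn t : ℚ)) - 1) / ((d : ℚ) - 1) = (n : ℚ) →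
      Nat.card (RootedLabeledCactus nn) =
        n ^ (d - 1) * ∏ t : Fin d, ((n - 1).choose (nn t - 1) * (nn t - 1)!)) ∧
    ((¬ ∃ n : ℕ, ((∑ t : Fin d, (nn t : ℚ)) - 1) / ((d : ℚ) - 1) = (n : ℚ)) →
      Nat.card (RootedLabeledCactus nn) = 0) := by
  -- Any cactus makes the count for its own size nonzero, so its size is forced.
  have hsize : ∀ C : RootedLabeledCactus nn,
      ((∑ t : Fin d, (nn t : ℚ)) - 1) / ((d : ℚ) - 1) = (C.size : ℚ) := by
    intro C
    by_contra hC
    have h := Cactus.card_size hd hnn C.size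
    rw [if_neg hC, Finite.card_eq_zero_iff] at h
    exact h.elim ⟨C, rfl⟩
  refine ⟨inferInstance, Cactus.card_size hd hnn, fun n hn => ?_, fun hn => ?_⟩
  · have h := Cactus.card_size hd hnn n
    rw [if_pos hn] at h
    rw [← h]
    exact Nat.card_congr (Equiv.subtypeUnivEquiv fun C => by
      have := (hsize C).symm.trans hn
      exact_mod_cast this).symm
  · have : IsEmpty (RootedLabeledCactus nn) := ⟨fun C => hn ⟨C.size, hsize C⟩⟩
    exact Nat.card_of_isEmpty
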